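/- **Setting.** Let $M\ge 1$ be an integer, let $K_n(\zeta)=\int_0^\infty\cosh(n\vartheta)e^{-\zeta\cosh\vartheta}\,d\vartheta$, and for $\zeta>0$, $\ell=0,1$ let $P_n^{(\ell)}(x)=P_n^{(\ell)}(x;\zeta)$, $n\ge 0$, be the orthonormal polynomials (degree $n$, leading coefficient $c_n^{(\ell)}>0$) for the inner product $(f,g)_{\omega^{(\ell)}}=\int_1^\infty fg\,\omega^{(\ell)}dx$ with weight $\omega^{(\ell)}(x;\zeta)=K_1(\zeta)^{-1}(x^2-1)^{\ell-1/2}e^{-\zeta x}$. Let $x^{(\ell)}_{i,n}$ be the zeros of $P_n^{(\ell)}$ and put $$a_n^{(\ell)}=(xP_n^{(\ell)},P_{n+1}^{(\ell)})_{\omega^{(\ell)}},\quad b_n^{(\ell)}=(xP_n^{(\ell)},P_n^{(\ell)})_{\omega^{(\ell)}},\quad p_n=\frac{c_n^{(0)}}{c_n^{(1)}},\quad q_n=\frac{c_n^{(1)}}{c_{n+1}^{(0)}}\Big(\sum_{i=1}^{n+2}x^{(0)}_{i,n+2}-\sum_{i=1}^{n}x^{(1)}_{i,n}\Big),\quad r_n=\frac{c_{n-1}^{(1)}}{c_{n+1}^{(0)}}.$$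 Let $J_n^{(\ell)}$ be the symmetric tridiagonal matrix of order $n+1$ with diagonal $b_0^{(\ell)},\dots,b_n^{(\ell)}$ and off-diagonal $a_0^{(\ell)},\dots,a_{n-1}^{(\ell)}$, let $J_n$ be the $(n+1)\times(n+2)$ matrix whose row $i$ ($0\le i\le n$) has the entries $p_i,q_i,r_{i+1}$ in the columns $i,i+1,i+2$ (as far as these exist; columns counted from $0$) and zeros elsewhere, and $$A_M^0=\begin{pmatrix}J_M^{(0)}&0\\0&J_{M-1}^{(1)}\end{pmatrix},\qquad A_M^1=\begin{pmatrix}0&J_{M-1}^T\\J_{M-1}&0\end{pmatrix}.$$ Let $Q_{2M}(x)=P_{M+1}^{(0)}(x)P_M^{(1)}(-x)+P_{M+1}^{(0)}(-x)P_M^{(1)}(x)$. Its zeros are $z_{i,M}$, $i=\pm1,\dots,\pm M$, with $z_{-i,M}=-z_{i,M}$ and $1<z_{1,M}<\dots<z_{M,M}$. Put $\hat\lambda_{0,M}=0$, $\hat\lambda_{i,M}=\sqrt{z_{i,M}^2-1}/z_{i,M}$ for $i\neq0$, and $y_{i,M}=(u_{i,M}^T,v_{i,M}^T)^T$, where for $i\ne0$,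 with $z=z_{i,M}$, $$u_{i,M}=\big(P_k^{(0)}(z)P_M^{(1)}(-z)+P_k^{(0)}(-z)P_M^{(1)}(z)\big)_{k=0}^{M},\quad v_{i,M}=\sqrt{z^2-1}\,\big(P_k^{(1)}(z)P_M^{(1)}(-z)-P_k^{(1)}(-z)P_M^{(1)}(z)\big)_{k=0}^{M-1},$$ and $u_{0,M}=\big(P_k^{(0)}(1)P_{M+1}^{(0)}(-1)-P_k^{(0)}(-1)P_{M+1}^{(0)}(1)\big)_{k=0}^{M}$, $v_{0,M}=0$. **The moment system.** Let $|u|<1$, $\theta>0$, $\zeta=1/\theta$, $U^0=(1-u^2)^{-1/2}$, $U^1=uU^0$, $p^0=\sqrt{1+p^2}$, $E=U^0p^0-U^1p$, $p_{<1>}=U^1E-p$, $g=\frac{1}{2K_1(\zeta)}e^{-E/\theta}$, and $\langle f,h\rangle_g=\int_{\mathbb R}g^{-1}fh\,\frac{dp}{p^0}$. Let $\tilde P_n^{(0)}=gP_n^{(0)}(E)$, $\tilde P_n^{(1)}=g\,(U^0)^{-1}p_{<1>}P_n^{(1)}(E)$ and $$\mathcal P_M[u,\theta]=(\tilde P_0^{(0)},\tilde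 P_1^{(0)},\tilde P_0^{(1)},\tilde P_2^{(0)},\tilde P_1^{(1)},\dots,\tilde P_M^{(0)},\tilde P_{M-1}^{(1)})^T,$$ and let $P_M^p$ be the permutation matrix that takes $(\tilde P_0^{(0)},\dots,\tilde P_M^{(0)},\tilde P_0^{(1)},\dots,\tilde P_{M-1}^{(1)})^T$ to $\mathcal P_M[u,\theta]$. For a state $W=(\rho,u,\theta,\Pi,\tilde n^1,f_3^0,f_2^1,\dots,f_M^0,f_{M-1}^1)^T\in\mathbb R^{2M+1}$ (only $(\rho,u,\theta)$ if $M=1$, and then $\Pi=\tilde n^1=0$ below) let $f_M(W)=(f_0^0,f_1^0,f_0^1,f_2^0,f_1^1,\dots,f_M^0,f_{M-1}^1)^T$, where $$f_0^0=\frac{\rho}{c_0^{(0)}}-c_0^{(0)}\Pi,\quad f_n^0=-P_n^{(0)}(0)\,\Pi\ (n=1,2),\quad f_n^1=-P_n^{(1)}(0)\,\tilde n^1\ (n=0,1)$$ and the remaining entries are those of $W$; let $F_W(p)=\mathcal P_M[u,\theta](p)^Tf_M(W)$ be the corresponding distribution. Let $D_M=D_M(W)$ be the matrix with entries $(D_M)_{jk}=\big\langle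 \partial F_W/\partial W_k,\ (\mathcal P_M[u,\theta])_j\big\rangle_g$, and $$M_M^t=P_M^p\,(U^0A_M^0-U^1A_M^1)\,(P_M^p)^T,\quad M_M^x=P_M^p\,(U^1A_M^0-U^0A_M^1)\,(P_M^p)^T,\quad B_M^0=M_M^tD_M,\quad B_M^1=M_M^xD_M .$$ The moment system of order $M$ of the one-dimensional special relativistic Boltzmann equation is $B_M^0\,\partial_tW+B_M^1\,\partial_xW=S(W)$; its eigenvalues and eigenvectors are the solutions $(\lambda,r)$, $r\neq0$, of $B_M^1r=\lambda B_M^0r$. **Theorem.** Let $M\ge1$ and let $W$ satisfy $\rho>0$, $|u|<1$, $\theta>0$ and $\Pi>-\rho\theta$ (the last condition is void for $M=1$). Then the zeros of $Q_{2M}$ are as described above, $A_M^0$ is invertible, and the pair $(A_M^0,A_M^1)$ has the $2M+1$ pairwise different generalized eigenvalues $\hat\lambda_{i,M}$ with eigenvectors $y_{i,M}\ne0$, that is, $A_M^1y_{i,M}=\hat\lambda_{i,M}A_M^0y_{i,M}$. The matrices $D_M$ and $B_M^0$ are invertible, and the eigenvalues of the moment system are the $2M+1$ pairwise different numbers $$\lambda_{i,M}=\frac{u-\hat\lambda_{i,M}}{1-u\hat\lambda_{i,M}},\qquad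 i=-M,\dots,M$$ (so that $\det(\lambda I-(B_M^0)^{-1}B_M^1)=\prod_{i=-M}^{M}(\lambda-\lambda_{i,M})$). They satisfy $|\lambda_{i,M}|<1$, and corresponding eigenvectors are $r_{i,M}=D_M^{-1}P_M^p\,y_{i,M}\ne0$, $i=-M,\dots,M$. -/

import Mathlib

open MeasureTheory

noncomputable section

namespace RelMoment

/-! ### Weights, inner products and orthonormal polynomials -/

/-- Modified Bessel function of the second kind `K_n(ζ)`. -/
def besselK (n : ℕ) (ζ : ℝ) : ℝ :=
  ∫ t in Set.Ioi (0 : ℝ), Real.cosh (n * t) * Real.exp (-ζ * Real.cosh t)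

/-- The weight `ω^{(ℓ)}(x; ζ) = (x² - 1)^{ℓ - 1/2} exp(-ζ x) / K₁(ζ)`. -/
def weight (ℓ : Fin 2) (ζ x : ℝ) : ℝ :=
  (x ^ 2 - 1) ^ (((ℓ : ℕ) : ℝ) - 1 / 2) / besselK 1 ζ * Real.exp (-ζ * x)

/-- The inner product `(f, g)_{ω^{(ℓ)}}` of two polynomials on `[1, ∞)`. -/
def wip (ℓ : Fin 2) (ζ : ℝ) (f g : Polynomial ℝ) : ℝ :=
  ∫ x in Set.Ioi (1 : ℝ), f.eval x * g.eval x * weight ℓ ζ x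

/-- The orthonormal polynomials `P_n^{(ℓ)}(·; ζ)` with positive leading coefficient,
obtained from `1, X, X², …` by the Gram-Schmidt process. -/
def orthPoly (ℓ : Fin 2) (ζ : ℝ) (n : ℕ) : Polynomial ℝ :=
  let q : Polynomial ℝ := Polynomial.X ^ n -
    ∑ k : Fin n, Polynomial.C (wip ℓ ζ (Polynomial.X ^ n) (orthPoly ℓ ζ k)) * orthPoly ℓ ζ k
  Polynomial.C (Real.sqrt (wip ℓ ζ q q))⁻¹ * q
termination_by n
decreasing_by all_goals exact k.2

/-- Leading coefficient `c_n^{(ℓ)}`. -/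
def lc (ℓ : Fin 2) (ζ : ℝ) (n : ℕ) : ℝ := (orthPoly ℓ ζ n).leadingCoeff

/-- Sum of the zeros `∑_i x_{i,n}^{(ℓ)}`. -/
def zeroSum (ℓ : Fin 2) (ζ : ℝ) (n : ℕ) : ℝ := (orthPoly ℓ ζ n).roots.sum

/-! ### Recurrence coefficients and matrices -/

def coefA (ℓ : Fin 2) (ζ : ℝ) (n : ℕ) : ℝ :=
  wip ℓ ζ (Polynomial.X * orthPoly ℓ ζ n) (orthPoly ℓ ζ (n + 1))

def coefB (ℓ : Fin 2) (ζ : ℝ) (n : ℕ) : ℝ :=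
  wip ℓ ζ (Polynomial.X * orthPoly ℓ ζ n) (orthPoly ℓ ζ n)

def coefP (ζ : ℝ) (n : ℕ) : ℝ := lc 0 ζ n / lc 1 ζ n

def coefQ (ζ : ℝ) (n : ℕ) : ℝ :=
  lc 1 ζ n / lc 0 ζ (n + 1) * (zeroSum 0 ζ (n + 2) - zeroSum 1 ζ n)

/-- `r_n` for `n ≥ 1`. -/
def coefR (ζ : ℝ) (n : ℕ) : ℝ := lc 1 ζ (n - 1) / lc 0 ζ (n + 1)

/-- The symmetric tridiagonal matrix of order `N` with diagonal `b_0, …, b_{N-1}` and off-diagonal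
`a_0, …, a_{N-2}`; this is `J_{N-1}^{(ℓ)}`. -/
def jacobiMat (ℓ : Fin 2) (ζ : ℝ) (N : ℕ) : Matrix (Fin N) (Fin N) ℝ :=
  fun i j =>
    if (i : ℕ) = j then coefB ℓ ζ i
    else if (j : ℕ) = i + 1 then coefA ℓ ζ i
    else if (i : ℕ) = j + 1 then coefA ℓ ζ j
    else 0

/-- The `N × (N+1)` matrix `J_{N-1}`, whose row `i` is `(0, …, 0, p_i, q_i, r_{i+1}, 0, …)` with
`p_i` on the diagonal. -/
def crossMat (ζ : ℝ) (N : ℕ) : Matrix (Fin N) (Fin (N + 1)) ℝ :=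
  fun i j =>
    if (j : ℕ) = i then coefP ζ i
    else if (j : ℕ) = i + 1 then coefQ ζ i
    else if (j : ℕ) = i + 2 then coefR ζ (i + 1)
    else 0

/-- Block index set: `inl n` stands for `P_n^{(0)}`, `0 ≤ n ≤ M`, and `inr n` for `P_n^{(1)}`,
`0 ≤ n ≤ M - 1`. -/
abbrev Blk (M : ℕ) : Type := Fin (M + 1) ⊕ Fin M

def matA0 (M : ℕ) (ζ : ℝ) : Matrix (Blk M) (Blk M) ℝ :=
  Matrix.fromBlocks (jacobiMat 0 ζ (M + 1)) 0 0 (jacobiMat 1 ζ M)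

def matA1 (M : ℕ) (ζ : ℝ) : Matrix (Blk M) (Blk M) ℝ :=
  Matrix.fromBlocks 0 (crossMat ζ M).transpose (crossMat ζ M) 0

/-! ### Generalized eigenvalues and eigenvectors of the pair -/

/-- `Q_{2M}(x; ζ) = P_{M+1}^{(0)}(x) P_M^{(1)}(-x) + P_{M+1}^{(0)}(-x) P_M^{(1)}(x)`. -/
def polyQ (M : ℕ) (ζ x : ℝ) : ℝ :=
  (orthPoly 0 ζ (M + 1)).eval x * (orthPoly 1 ζ M).eval (-x)
    + (orthPoly 0 ζ (M + 1)).eval (-x) * (orthPoly 1 ζ M).eval x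

/-- `z_i`, `i = ±1, …, ±M`, is the list of all zeros of `Q_{2M}(·; ζ)`: it is odd in `i`, and
`1 < z_1 < ⋯ < z_M`. (Only the values at `1 ≤ |i| ≤ M` matter.) -/
structure IsZeroList (M : ℕ) (ζ : ℝ) (z : ℤ → ℝ) : Prop where
  odd : ∀ i, z (-i) = -z i
  one_lt : ∀ i ∈ Set.Icc (1 : ℤ) M, 1 < z i
  strictMonoOn : StrictMonoOn z (Set.Icc (1 : ℤ) M)
  zeros : ∀ x : ℝ, polyQ M ζ x = 0 ↔ ∃ i ∈ Set.Icc (-(M : ℤ)) M, i ≠ 0 ∧ x = z i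

/-- `λ̂_{i,M}`: zero for `i = 0`, and `√(z_i² - 1) / z_i` otherwise. -/
def lamHat (z : ℤ → ℝ) (i : ℤ) : ℝ :=
  if i = 0 then 0 else Real.sqrt (z i ^ 2 - 1) / z i

/-- The generalized eigenvectors `y_{i,M} = (u_{i,M}, v_{i,M})`. -/
def genVec (M : ℕ) (ζ : ℝ) (z : ℤ → ℝ) (i : ℤ) : Blk M → ℝ :=
  if i = 0 then
    Sum.elim
      (fun k => (orthPoly 0 ζ k).eval 1 * (orthPoly 0 ζ (M + 1)).eval (-1)
        - (orthPoly 0 ζ k).eval (-1) * (orthPoly 0 ζ (M + 1)).eval 1)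
      (fun _ => 0)
  else
    Sum.elim
      (fun k => (orthPoly 0 ζ k).eval (z i) * (orthPoly 1 ζ M).eval (-z i)
        + (orthPoly 0 ζ k).eval (-z i) * (orthPoly 1 ζ M).eval (z i))
      (fun k => Real.sqrt (z i ^ 2 - 1) *
        ((orthPoly 1 ζ k).eval (z i) * (orthPoly 1 ζ M).eval (-z i)
          - (orthPoly 1 ζ k).eval (-z i) * (orthPoly 1 ζ M).eval (z i)))

/-! ### Kinematics and the weighted polynomial basis (units with `c = m = 1`) -/

def U0 (u : ℝ) : ℝ := 1 / Real.sqrt (1 - u ^ 2)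

def U1 (u : ℝ) : ℝ := u / Real.sqrt (1 - u ^ 2)

/-- `p⁰` on the mass shell. -/
def p0 (p : ℝ) : ℝ := Real.sqrt (1 + p ^ 2)

/-- `E = U_α p^α`. -/
def energy (u p : ℝ) : ℝ := U0 u * p0 p - U1 u * p

/-- `p_{<1>} = -p^{<1>}`, where `p^{<1>} = p - E U¹`. -/
def pLow (u p : ℝ) : ℝ := -(p - energy u p * U1 u)

/-- `g^{(0)}_{[u,θ]}`. -/
def gEq (u θ p : ℝ) : ℝ := 1 / (2 * besselK 1 θ⁻¹) * Real.exp (-(energy u p / θ))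

/-- The polynomial in position `j` of the ordering
`P_0^{(0)}, P_1^{(0)}, P_0^{(1)}, P_2^{(0)}, P_1^{(1)}, …` (positions start at `0`). -/
def posPoly (ζ : ℝ) (j : ℕ) : Polynomial ℝ :=
  if j = 0 ∨ Odd j then orthPoly 0 ζ ((j + 1) / 2) else orthPoly 1 ζ (j / 2 - 1)

/-- The basis function in position `j`: `g P_n^{(0)}(E)` or `g (U⁰)⁻¹ P_n^{(1)}(E) p_{<1>}`. -/
def basisFn (u θ : ℝ) (j : ℕ) (p : ℝ) : ℝ :=
  if j = 0 ∨ Odd j then gEq u θ p * (posPoly θ⁻¹ j).eval (energy u p)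
  else gEq u θ p * (U0 u)⁻¹ * (posPoly θ⁻¹ j).eval (energy u p) * pLow u p

/-- The inner product `<f, h>_{g^{(0)}_{[u,θ]}}`. -/
def gip (u θ : ℝ) (f h : ℝ → ℝ) : ℝ :=
  ∫ p : ℝ, 1 / gEq u θ p * f p * h p / p0 p

/-- The permutation matrix which takes the block ordering to the interlaced ordering of the
basis functions: `P_0^{(0)}` has position `0`, `P_n^{(0)}` has position `2n - 1` for `n ≥ 1`, and
`P_n^{(1)}` has position `2n + 2`. -/
def permMat (M : ℕ) : Matrix (Fin (2 * M + 1)) (Blk M) ℝ :=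
  fun j b =>
    if (j : ℕ) = Sum.elim (fun n : Fin (M + 1) => 2 * (n : ℕ) - 1)
      (fun n : Fin M => 2 * (n : ℕ) + 2) b then 1 else 0

/-! ### The moment system -/

/-- State vector `W_M = (ρ, u, θ, Π, ñ¹, f_3^0, f_2^1, …, f_M^0, f_{M-1}^1)`. -/
abbrev State (M : ℕ) : Type := Fin (2 * M + 1) → ℝ

/-- Component of a state vector; components beyond the length are `0` (so `Π = 0` if `M = 1`). -/
def State.comp {M : ℕ} (W : State M) (k : ℕ) : ℝ :=
  if h : k < 2 * M + 1 then W ⟨k, h⟩ else 0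

def State.rho {M : ℕ} (W : State M) : ℝ := W.comp 0

def State.vel {M : ℕ} (W : State M) : ℝ := W.comp 1

def State.theta {M : ℕ} (W : State M) : ℝ := W.comp 2

def State.bulk {M : ℕ} (W : State M) : ℝ := W.comp 3

/-- The matrix `D_M^W(θ)` with `f_M = D_M^W W_M`. The columns of `Π` and `ñ¹` hold the negatives of
the values at `0` of `P_0^{(0)}, P_1^{(0)}, P_2^{(0)}` and `P_0^{(1)}, P_1^{(1)}`, for instance
`-P_1^{(0)}(0) = c_1^{(0)} x_{1,1}^{(0)}`, because `∫ f dp/p⁰ = ρ (G - 2/ζ) - Π`,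
`∫ E f dp/p⁰ = ρ`, `∫ E² f dp/p⁰ = ρ (G - 1/ζ)`, `∫ (U⁰)⁻¹ p_{<1>} f dp/p⁰ = -ñ¹` and
`∫ E (U⁰)⁻¹ p_{<1>} f dp/p⁰ = 0`. -/
def matDW (M : ℕ) (θ : ℝ) : Matrix (Fin (2 * M + 1)) (Fin (2 * M + 1)) ℝ :=
  fun j k =>
    if (k : ℕ) = 0 then (if (j : ℕ) = 0 then (lc 0 θ⁻¹ 0)⁻¹ else 0)
    else if (k : ℕ) = 1 ∨ (k : ℕ) = 2 then 0
    else if (k : ℕ) = 3 then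
      (if (j : ℕ) = 0 ∨ (j : ℕ) = 1 ∨ (j : ℕ) = 3 then -(posPoly θ⁻¹ j).eval 0 else 0)
    else if (k : ℕ) = 4 then
      (if (j : ℕ) = 2 ∨ (j : ℕ) = 4 then -(posPoly θ⁻¹ j).eval 0 else 0)
    else (if j = k then 1 else 0)

/-- The projected distribution `Π_M[u,θ] f = [𝒫_M[u,θ], D_M^W W_M]` as a function of the state `W`
and of the momentum `p`. -/
def projDist {M : ℕ} (W : State M) (p : ℝ) : ℝ :=
  ∑ j : Fin (2 * M + 1), basisFn W.vel W.theta j p * (matDW M W.theta).mulVec W j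

/-- The matrix `D_M`: its column `k` is the coefficient vector of
`Π_M[u,θ] (∂ (Π_M[u,θ] f) / ∂ W_k)` in the basis `𝒫_M[u,θ]`, so that
`Π_M[u,θ] (∂ (Π_M[u,θ] f) / ∂ s) = [𝒫_M[u,θ], D_M ∂W_M/∂s]_M` for `s = t, x`. -/
def matD {M : ℕ} (W : State M) : Matrix (Fin (2 * M + 1)) (Fin (2 * M + 1)) ℝ :=
  fun j k => gip W.vel W.theta
    (fun p => deriv (fun s : ℝ => projDist (M := M) (Function.update W k s) p) (W k))
    (basisFn W.vel W.theta j)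

def matMt (M : ℕ) (u θ : ℝ) : Matrix (Fin (2 * M + 1)) (Fin (2 * M + 1)) ℝ :=
  -U1 u • (permMat M * matA1 M θ⁻¹ * (permMat M).transpose)
    + U0 u • (permMat M * matA0 M θ⁻¹ * (permMat M).transpose)

def matMx (M : ℕ) (u θ : ℝ) : Matrix (Fin (2 * M + 1)) (Fin (2 * M + 1)) ℝ :=
  -U0 u • (permMat M * matA1 M θ⁻¹ * (permMat M).transpose)
    + U1 u • (permMat M * matA0 M θ⁻¹ * (permMat M).transpose)

/-- `B_M^0` in the moment system `B_M^0 ∂W/∂t + B_M^1 ∂W/∂x = S(W)`. -/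
def matB0 {M : ℕ} (W : State M) : Matrix (Fin (2 * M + 1)) (Fin (2 * M + 1)) ℝ :=
  matMt M W.vel W.theta * matD W

/-- `B_M^1` in the moment system. -/
def matB1 {M : ℕ} (W : State M) : Matrix (Fin (2 * M + 1)) (Fin (2 * M + 1)) ℝ :=
  matMx M W.vel W.theta * matD W

/-- `λ_{i,M} = (u - λ̂_{i,M}) / (1 - u λ̂_{i,M})`. -/
def lam (u : ℝ) (z : ℤ → ℝ) (i : ℤ) : ℝ := (u - lamHat z i) / (1 - u * lamHat z i)

/-- `r_{i,M} = D_M⁻¹ P_M^p y_{i,M}`. -/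
def eigVec {M : ℕ} (W : State M) (z : ℤ → ℝ) (i : ℤ) : Fin (2 * M + 1) → ℝ :=
  ((matD W)⁻¹ * permMat M).mulVec (genVec M W.theta⁻¹ z i)

/-- The numbers `μ_i`, `-M ≤ i ≤ M`, with vectors `y_i`, are the eigenvalues and eigenvectors of the
generalized eigenvalue problem `A¹ y = μ A⁰ y` of order `2M + 1`: the matrix `A⁰` is invertible,
the `μ_i` are pairwise different and are all the roots of the characteristic polynomial of
`(A⁰)⁻¹ A¹`, and `y_i` is an eigenvector for `μ_i`. -/
structure IsEigenSystem {ι : Type} [Fintype ι] [DecidableEq ι] (M : ℕ) (A0 A1 : Matrix ι ι ℝ)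
    (μ : ℤ → ℝ) (y : ℤ → ι → ℝ) : Prop where
  isUnit_det : IsUnit A0.det
  injOn : Set.InjOn μ (Set.Icc (-(M : ℤ)) M)
  charpoly_eq : (A0⁻¹ * A1).charpoly =
    ∏ i ∈ Finset.Icc (-(M : ℤ)) M, (Polynomial.X - Polynomial.C (μ i))
  ne_zero : ∀ i ∈ Set.Icc (-(M : ℤ)) M, y i ≠ 0
  eigen : ∀ i ∈ Set.Icc (-(M : ℤ)) M, A1.mulVec (y i) = μ i • A0.mulVec (y i)

end RelMoment

end

/-!
On the mass shell the pair `x = E`, `n = (U⁰)⁻¹ p_{<1>}` satisfies `n² = x² - 1`. The functions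
`P_k^{(0)}(x)` and `n P_k^{(1)}(x)` form an orthonormal basis, for the equilibrium measure, of the
functions `f(x) + n g(x)` with polynomial `f` and `g`, and `A⁰`, `A¹` are the truncated Gram
matrices of multiplication by `x` and by `n`. Since `|u n| < x` on the shell for `|u| < 1`, the
matrix `A⁰ - u A¹` is positive definite.

A combination of the evaluations at `(x, n)` and `(-x, -n)` that annihilates `P_{M+1}^{(0)}` and
`n P_M^{(1)}` does not feel the truncation, hence gives an eigenvector with eigenvalue `n / x`.
Such a combination exists at the zeros of `Q_{2M}` and, with `n = 0`, at `x = 1`. By Gauss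
quadrature `P_M^{(1)}` alternates in sign on the zeros of `P_{M+1}^{(0)}`, while
`P_{M+1}^{(0)}(-x)` has constant sign there; so `Q_{2M}` changes sign `M` times on `(1, ∞)` and,
being even of degree at most `2M`, has no other zeros than these and their negatives.

The derivatives of the distribution `F_W` with respect to velocity and temperature are again `g`
times functions of the form `f(x) + n g(x)`. A null vector of `D_M` is a tangent direction whose
moments up to order `M` vanish; the lowest moments force its components to vanish one after the
other because `ρ > 0` and `Π > -ρθ`. Finally, a Lorentz boost replaces `(A⁰, A¹)` by
`(U⁰ A⁰ - U¹ A¹, U¹ A⁰ - U⁰ A¹)`, which acts on the eigenvalues by `μ ↦ (u - μ) / (1 - u μ)`.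
-/

noncomputable section

namespace RelMoment

open Polynomial

/-! ### Exponential moments in the rapidity variable -/

section

open Real

/-- The moments `∫ cosh(t)ⁿ exp(-ζ cosh t) dt`. -/
def coshMoment (ζ : ℝ) (n : ℕ) : ℝ := ∫ t : ℝ, cosh t ^ n * exp (-ζ * cosh t)

/-- The functional `f ↦ ∫ f(cosh t) exp(-ζ cosh t) dt` on polynomials, defined through the
moments so that it is linear for every `ζ`. -/
def expMom (ζ : ℝ) : ℝ[X] →ₗ[ℝ] ℝ := lsum fun n => coshMoment ζ n • LinearMap.id

lemma expMom_eq_sum (ζ : ℝ) (f : ℝ[X]) :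
    expMom ζ f = ∑ n ∈ Finset.range (f.natDegree + 1), f.coeff n * coshMoment ζ n := by
  simp only [expMom, lsum_apply, LinearMap.smul_apply, LinearMap.id_apply, smul_eq_mul]
  rw [sum_over_range _ fun n => mul_zero _]
  exact Finset.sum_congr rfl fun n _ => mul_comm _ _

lemma sq_div_four_le_cosh (t : ℝ) : t ^ 2 / 4 ≤ cosh t := by
  rw [← cosh_abs, cosh_eq]
  have hexp := quadratic_le_exp_of_nonneg (abs_nonneg t)
  rw [sq_abs] at hexp
  linarith [exp_pos (-|t|), abs_nonneg t]

lemma integrable_exp_neg_mul_cosh {ζ : ℝ} (hζ : 0 < ζ) :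
    Integrable (fun t : ℝ => exp (-ζ * cosh t)) := by
  refine (integrable_exp_neg_mul_sq (b := ζ / 4) (by positivity)).mono' (by fun_prop)
    (.of_forall fun t => ?_)
  rw [norm_of_nonneg (exp_pos _).le, exp_le_exp]
  nlinarith [sq_div_four_le_cosh t]

lemma integrable_cosh_pow_mul_exp {ζ : ℝ} (hζ : 0 < ζ) (n : ℕ) :
    Integrable (fun t : ℝ => cosh t ^ n * exp (-ζ * cosh t)) := by
  refine ((integrable_exp_neg_mul_cosh (half_pos hζ)).const_mul
    (n.factorial / (ζ / 2) ^ n)).mono' (by fun_prop) (.of_forall fun t => ?_)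
  have := cosh_pos t
  rw [norm_of_nonneg (by positivity)]
  have hpow : cosh t ^ n ≤ n.factorial / (ζ / 2) ^ n * exp (ζ / 2 * cosh t) := by
    have h := pow_div_factorial_le_exp (ζ / 2 * cosh t) (by positivity) n
    rw [mul_pow, div_le_iff₀ (by positivity)] at h
    rw [div_mul_eq_mul_div, le_div_iff₀ (by positivity)]
    linarith
  calc cosh t ^ n * exp (-ζ * cosh t)
      ≤ (n.factorial / (ζ / 2) ^ n * exp (ζ / 2 * cosh t)) * exp (-ζ * cosh t) := by gcongr
    _ = n.factorial / (ζ / 2) ^ n * exp (-(ζ / 2) * cosh t) := by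
      rw [mul_assoc, ← exp_add]; ring_nf

lemma integrable_eval_cosh_mul_exp {ζ : ℝ} (hζ : 0 < ζ) (f : ℝ[X]) :
    Integrable (fun t : ℝ => f.eval (cosh t) * exp (-ζ * cosh t)) := by
  simp only [eval_eq_sum_range, Finset.sum_mul, mul_assoc]
  exact integrable_finsetSum _ fun n _ => (integrable_cosh_pow_mul_exp hζ n).const_mul _

lemma expMom_eq_integral {ζ : ℝ} (hζ : 0 < ζ) (f : ℝ[X]) :
    expMom ζ f = ∫ t : ℝ, f.eval (cosh t) * exp (-ζ * cosh t) := by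
  simp only [expMom_eq_sum, coshMoment, eval_eq_sum_range, Finset.sum_mul, mul_assoc,
    ← integral_const_mul]
  exact (integral_finsetSum _ fun n _ => (integrable_cosh_pow_mul_exp hζ n).const_mul _).symm

lemma expMom_pos {ζ : ℝ} (hζ : 0 < ζ) {f : ℝ[X]} (hf : f ≠ 0)
    (hnonneg : ∀ x : ℝ, 1 ≤ x → 0 ≤ f.eval x) : 0 < expMom ζ f := by
  obtain ⟨x, hx, hfx⟩ : ∃ x ∈ Set.Ici (1 : ℝ), ¬ f.IsRoot x :=
    ((Set.Ici_infinite 1).sdiff f.roots.toFinset.finite_toSet).nonempty.imp fun x hx => by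
      simpa [hf] using hx
  rw [expMom_eq_integral hζ]
  refine integral_pos_of_integrable_nonneg_nonzero (x := arcosh x) (by fun_prop)
    (integrable_eval_cosh_mul_exp hζ f) (fun t => ?_) ?_
  · exact mul_nonneg (hnonneg _ (one_le_cosh t)) (exp_pos _).le
  · rw [cosh_arcosh hx]
    exact mul_ne_zero hfx (exp_pos _).ne'

lemma integrable_sinh_mul_eval_cosh_mul_exp {ζ : ℝ} (hζ : 0 < ζ) (f : ℝ[X]) :
    Integrable (fun t : ℝ => sinh t * f.eval (cosh t) * exp (-ζ * cosh t)) := by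
  refine (integrable_eval_cosh_mul_exp hζ (X * f)).mono (by fun_prop) (.of_forall fun t => ?_)
  simp only [norm_mul, eval_mul, eval_X, norm_eq_abs]
  have hsinh : |sinh t| ≤ |cosh t| := by
    rw [← sq_le_sq, cosh_sq]
    linarith
  gcongr ?_ * _ * _

/-- Integration of the derivative of `sinh t * f(cosh t) * exp(-ζ cosh t)`. -/
lemma expMom_by_parts {ζ : ℝ} (hζ : 0 < ζ) (f : ℝ[X]) :
    expMom ζ (X * f + (X ^ 2 - 1) * (derivative f - C ζ * f)) = 0 := by
  rw [expMom_eq_integral hζ]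
  refine integral_eq_zero_of_hasDerivAt_of_integrable
    (f := fun t => sinh t * f.eval (cosh t) * exp (-ζ * cosh t)) (fun t => ?_)
    (integrable_eval_cosh_mul_exp hζ _) (integrable_sinh_mul_eval_cosh_mul_exp hζ f)
  refine (((hasDerivAt_sinh t).mul ((f.hasDerivAt (cosh t)).comp t (hasDerivAt_cosh t))).mul
    (((hasDerivAt_cosh t).const_mul (-ζ)).exp)).congr_deriv ?_
  simp only [Function.comp_apply, Pi.mul_apply, eval_add, eval_mul, eval_sub, eval_pow,
    eval_X, eval_one, eval_C]
  rw [cosh_sq]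
  ring

lemma hasDerivAt_coshMoment {ζ : ℝ} (hζ : 0 < ζ) (n : ℕ) :
    HasDerivAt (fun s => coshMoment s n) (-coshMoment ζ (n + 1)) ζ := by
  have hderiv := (hasDerivAt_integral_of_dominated_loc_of_deriv_le (μ := volume)
    (F := fun s t => cosh t ^ n * exp (-s * cosh t))
    (F' := fun s t => -(cosh t ^ (n + 1) * exp (-s * cosh t)))
    (bound := fun t => cosh t ^ (n + 1) * exp (-(ζ / 2) * cosh t))
    (s := Set.Ioi (ζ / 2)) (x₀ := ζ) (Ioi_mem_nhds (half_lt_self hζ))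
    (.of_forall fun s => by fun_prop) (integrable_cosh_pow_mul_exp hζ n) (by fun_prop)
    (.of_forall fun t s (_ : ζ / 2 < s) => ?_)
    (integrable_cosh_pow_mul_exp (half_pos hζ) (n + 1))
    (.of_forall fun t s _ => ?_)).2
  · rwa [integral_neg] at hderiv
  · have := cosh_pos t
    rw [norm_neg, norm_of_nonneg (by positivity)]
    gcongr
  · refine ((((hasDerivAt_id s).neg.mul_const (cosh t)).exp).const_mul (cosh t ^ n)).congr_deriv ?_
    simp only [id, Pi.neg_apply]
    ring

lemma expMom_X_mul (ζ : ℝ) (f : ℝ[X]) :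
    expMom ζ (X * f) = ∑ n ∈ Finset.range (f.natDegree + 1), f.coeff n * coshMoment ζ (n + 1) := by
  conv_lhs => rw [f.as_sum_range_C_mul_X_pow, Finset.mul_sum, map_sum]
  refine Finset.sum_congr rfl fun n _ => ?_
  rw [mul_left_comm, ← pow_succ', C_mul_X_pow_eq_monomial]
  simp [expMom, mul_comm]

lemma hasDerivAt_expMom {ζ : ℝ} (hζ : 0 < ζ) (f : ℝ[X]) :
    HasDerivAt (fun s => expMom s f) (-expMom ζ (X * f)) ζ := by
  simp only [expMom_eq_sum _ f, expMom_X_mul, ← Finset.sum_neg_distrib, ← mul_neg]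
  exact .fun_sum fun n _ => (hasDerivAt_coshMoment hζ n).const_mul _

/-! ### The weights `ω^{(ℓ)}` as linear functionals -/

/-- The functional `f ↦ (f, 1)_{ω^{(ℓ)}}`; the normalization `K₁(ζ)` is half of `∫ cosh t
exp(-ζ cosh t) dt`. -/
def weightFun (ℓ : Fin 2) (ζ : ℝ) : ℝ[X] →ₗ[ℝ] ℝ :=
  (expMom ζ X)⁻¹ • expMom ζ ∘ₗ LinearMap.mulLeft ℝ ((X ^ 2 - 1) ^ (ℓ : ℕ))

lemma weightFun_zero_apply (ζ : ℝ) (f : ℝ[X]) :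
    weightFun 0 ζ f = (expMom ζ X)⁻¹ * expMom ζ f := by
  simp [weightFun]

lemma weightFun_one_apply (ζ : ℝ) (f : ℝ[X]) :
    weightFun 1 ζ f = weightFun 0 ζ ((X ^ 2 - 1) * f) := by
  simp [weightFun]

lemma weightFun_apply (ℓ : Fin 2) (ζ : ℝ) (f : ℝ[X]) :
    weightFun ℓ ζ f = weightFun 0 ζ ((X ^ 2 - 1) ^ (ℓ : ℕ) * f) := by
  simp [weightFun]

lemma expMom_eq_two_mul_setIntegral {ζ : ℝ} (hζ : 0 < ζ) (f : ℝ[X]) :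
    expMom ζ f = 2 * ∫ t in Set.Ioi (0 : ℝ), f.eval (cosh t) * exp (-ζ * cosh t) := by
  rw [expMom_eq_integral hζ,
    ← integral_comp_abs (f := fun t => f.eval (cosh t) * exp (-ζ * cosh t))]
  simp only [cosh_abs]

lemma expMom_X_eq_two_mul_besselK {ζ : ℝ} (hζ : 0 < ζ) : expMom ζ X = 2 * besselK 1 ζ := by
  simp [expMom_eq_two_mul_setIntegral hζ, besselK]

lemma expMom_X_pos {ζ : ℝ} (hζ : 0 < ζ) : 0 < expMom ζ X :=
  expMom_pos hζ X_ne_zero fun x hx => by rw [eval_X]; linarith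

lemma sinh_mul_weight_cosh (ℓ : Fin 2) (ζ : ℝ) {t : ℝ} (ht : 0 < t) :
    sinh t * weight ℓ ζ (cosh t) =
      (cosh t ^ 2 - 1) ^ (ℓ : ℕ) / besselK 1 ζ * exp (-ζ * cosh t) := by
  have hsinh : 0 < sinh t := sinh_pos_iff.2 ht
  have hsq : cosh t ^ 2 - 1 = sinh t ^ 2 := by rw [cosh_sq]; ring
  rw [weight, hsq, rpow_sub (by positivity), ← sqrt_eq_rpow, sqrt_sq hsinh.le, rpow_natCast]
  field_simp

lemma cosh_image_Ioi_zero : cosh '' Set.Ioi 0 = Set.Ioi 1 := by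
  ext x
  exact ⟨fun ⟨t, ht, h⟩ => h ▸ one_lt_cosh.2 (ne_of_gt ht),
    fun hx => ⟨arcosh x, arcosh_pos hx, cosh_arcosh (le_of_lt hx)⟩⟩

lemma wip_eq_weightFun (ℓ : Fin 2) {ζ : ℝ} (hζ : 0 < ζ) (f g : ℝ[X]) :
    wip ℓ ζ f g = weightFun ℓ ζ (f * g) := by
  have hsubst : wip ℓ ζ f g = ∫ t in Set.Ioi (0 : ℝ), (besselK 1 ζ)⁻¹ *
      (((X ^ 2 - 1) ^ (ℓ : ℕ) * (f * g)).eval (cosh t) * exp (-ζ * cosh t)) := by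
    rw [wip, ← cosh_image_Ioi_zero, integral_image_eq_integral_abs_deriv_smul measurableSet_Ioi
      (fun t _ => (hasDerivAt_cosh t).hasDerivWithinAt)
      (cosh_strictMonoOn.injOn.mono Set.Ioi_subset_Ici_self)]
    refine setIntegral_congr_fun measurableSet_Ioi fun t (ht : 0 < t) => ?_
    simp only [smul_eq_mul, abs_of_pos (sinh_pos_iff.2 ht), eval_mul, eval_pow, eval_sub, eval_X,
      eval_one]
    linear_combination (eval (cosh t) f * eval (cosh t) g) * sinh_mul_weight_cosh ℓ ζ ht
  rw [hsubst, integral_const_mul, weightFun_apply, weightFun_zero_apply,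
    expMom_X_eq_two_mul_besselK hζ, expMom_eq_two_mul_setIntegral hζ, mul_inv]
  ring

end

/-! ### Orthonormal polynomials of a positive functional -/

/-- `Λ` is positive on the nonzero polynomials that are nonnegative on `s`. -/
def IsPositiveOn (Λ : ℝ[X] →ₗ[ℝ] ℝ) (s : Set ℝ) : Prop :=
  ∀ f : ℝ[X], f ≠ 0 → (∀ x ∈ s, 0 ≤ f.eval x) → 0 < Λ f

/-- `P` is the sequence of orthonormal polynomials with positive leading coefficients for the
inner product `(f, g) ↦ Λ (f * g)`. -/
structure IsOrthonormal (Λ : ℝ[X] →ₗ[ℝ] ℝ) (P : ℕ → ℝ[X]) : Prop where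
  degree_eq : ∀ n, (P n).degree = n
  leadingCoeff_pos : ∀ n, 0 < (P n).leadingCoeff
  map_mul : ∀ m n, Λ (P m * P n) = if m = n then 1 else 0

lemma IsPositiveOn.map_sq_pos {Λ : ℝ[X] →ₗ[ℝ] ℝ} {s : Set ℝ} (hΛ : IsPositiveOn Λ s) {f : ℝ[X]}
    (hf : f ≠ 0) : 0 < Λ (f ^ 2) :=
  hΛ _ (pow_ne_zero 2 hf) fun x _ => by rw [eval_pow]; positivity

namespace IsOrthonormal

variable {Λ : ℝ[X] →ₗ[ℝ] ℝ} {P : ℕ → ℝ[X]}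

lemma natDegree_eq (h : IsOrthonormal Λ P) (n : ℕ) : (P n).natDegree = n :=
  natDegree_eq_of_degree_eq_some (h.degree_eq n)

lemma ne_zero (h : IsOrthonormal Λ P) (n : ℕ) : P n ≠ 0 :=
  leadingCoeff_ne_zero.1 (h.leadingCoeff_pos n).ne'

lemma coeff_self (h : IsOrthonormal Λ P) (n : ℕ) : (P n).coeff n = (P n).leadingCoeff := by
  rw [leadingCoeff, h.natDegree_eq]

lemma mem_span_of_degree_lt (h : IsOrthonormal Λ P) {N : ℕ} {f : ℝ[X]} (hf : f.degree < N) :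
    f ∈ Submodule.span ℝ (P '' Set.Iio N) := by
  have hspan := Sequence.span_degreeLT (⟨P, h.degree_eq⟩ : Sequence ℝ) (m := N)
    fun n _ => (h.leadingCoeff_pos n).ne'.isUnit
  exact hspan ▸ mem_degreeLT.2 hf

lemma expansion (h : IsOrthonormal Λ P) {N : ℕ} {f : ℝ[X]} (hf : f.degree < N) :
    f = ∑ k ∈ Finset.range N, Λ (f * P k) • P k := by
  refine Submodule.span_induction (p := fun f _ => f = ∑ k ∈ Finset.range N, Λ (f * P k) • P k)
    ?_ (by simp) (fun f g _ _ hf hg => ?_) (fun c f _ hf => ?_) (h.mem_span_of_degree_lt hf)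
  · rintro _ ⟨n, hn, rfl⟩
    simp [h.map_mul, Set.mem_Iio.1 hn]
  · simp only [add_mul, map_add, add_smul, Finset.sum_add_distrib, ← hf, ← hg]
  · simp only [smul_mul_assoc, map_smul, smul_assoc, ← Finset.smul_sum, ← hf]

lemma map_mul_eq_zero (h : IsOrthonormal Λ P) {n : ℕ} {f : ℝ[X]} (hf : f.degree < n) :
    Λ (f * P n) = 0 := by
  rw [h.expansion hf, Finset.sum_mul, map_sum]
  refine Finset.sum_eq_zero fun k hk => ?_
  rw [smul_mul_assoc, map_smul, h.map_mul, if_neg (Finset.mem_range.1 hk).ne, smul_zero]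

lemma map_mul_eq_coeff_div (h : IsOrthonormal Λ P) {n : ℕ} {f : ℝ[X]} (hf : f.natDegree ≤ n) :
    Λ (f * P n) = f.coeff n / (P n).leadingCoeff := by
  have hcoeff := congrArg (fun g => g.coeff n)
    (h.expansion (N := n + 1)
      (degree_le_natDegree.trans_lt (by exact_mod_cast Nat.lt_succ_of_le hf)))
  simp only [finsetSum_coeff, coeff_smul, Finset.sum_range_succ, smul_eq_mul, coeff_add,
    h.coeff_self] at hcoeff
  rw [hcoeff, Finset.sum_eq_zero, zero_add, mul_div_cancel_right₀ _ (h.leadingCoeff_pos n).ne']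
  intro k hk
  rw [coeff_eq_zero_of_natDegree_lt, mul_zero]
  rw [h.natDegree_eq]
  exact Finset.mem_range.1 hk

lemma map_mul_eq_of_natDegree_le_succ (h : IsOrthonormal Λ P) {n : ℕ} {f : ℝ[X]}
    (hf : f.natDegree ≤ n + 1) :
    Λ (f * P n) = (f.coeff n - f.coeff (n + 1) / (P (n + 1)).leadingCoeff * (P (n + 1)).coeff n) /
      (P n).leadingCoeff := by
  set c := f.coeff (n + 1) / (P (n + 1)).leadingCoeff with hc
  have hdeg : (f - c • P (n + 1)).natDegree ≤ n := by
    refine natDegree_le_pred (natDegree_sub_le_of_le hf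
      ((natDegree_smul_le _ _).trans (h.natDegree_eq _).le) |>.trans (max_self _).le) ?_
    rw [coeff_sub, coeff_smul, h.coeff_self, smul_eq_mul, hc,
      div_mul_cancel₀ _ (h.leadingCoeff_pos _).ne', sub_self]
  have hmul := h.map_mul_eq_coeff_div hdeg
  rwa [sub_mul, map_sub, smul_mul_assoc, map_smul, h.map_mul, if_neg n.succ_ne_self, smul_zero,
    sub_zero, coeff_sub, coeff_smul, smul_eq_mul] at hmul

section Roots

variable {s : Set ℝ}

lemma not_dvd_of_nonneg (h : IsOrthonormal Λ P) (hΛ : IsPositiveOn Λ s) {n : ℕ} {d : ℝ[X]}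
    (hd : 0 < d.natDegree) (hnonneg : ∀ x ∈ s, 0 ≤ d.eval x) : ¬ d ∣ P n := by
  rintro ⟨q, hq⟩
  obtain ⟨hd0, hq0⟩ := mul_ne_zero_iff.1 (hq ▸ h.ne_zero n)
  have hdeg : q.degree < n := by
    have hadd := congrArg natDegree hq
    rw [h.natDegree_eq, natDegree_mul hd0 hq0] at hadd
    rw [degree_eq_natDegree hq0]
    exact_mod_cast (by omega : q.natDegree < n)
  refine (hΛ (q * P n) (mul_ne_zero hq0 (h.ne_zero n)) fun x hx => ?_).ne' (h.map_mul_eq_zero hdeg)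
  rw [hq, eval_mul, eval_mul, mul_left_comm]
  exact mul_nonneg (hnonneg x hx) (mul_self_nonneg _)

lemma lt_of_isRoot (h : IsOrthonormal Λ P) {c : ℝ} (hΛ : IsPositiveOn Λ (Set.Ici c)) {n : ℕ}
    {x : ℝ} (hx : (P n).IsRoot x) : c < x := by
  by_contra! hle
  refine h.not_dvd_of_nonneg hΛ (d := X - C x) (by simp) (fun y hy => ?_) (dvd_iff_isRoot.2 hx)
  simpa using hle.trans hy

lemma nodup_roots (h : IsOrthonormal Λ P) (hΛ : IsPositiveOn Λ s) (n : ℕ) :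
    (P n).roots.Nodup := by
  refine Multiset.nodup_iff_count_le_one.2 fun x => ?_
  rw [count_roots]
  by_contra! hmult
  refine h.not_dvd_of_nonneg hΛ (d := (X - C x) ^ 2) (by simp [natDegree_pow]) (fun y _ => ?_)
    ((pow_dvd_pow _ hmult).trans (pow_rootMultiplicity_dvd (P n) x))
  rw [eval_pow]
  positivity

lemma splits (h : IsOrthonormal Λ P) (hΛ : IsPositiveOn Λ s) (n : ℕ) : (P n).Splits := by
  refine Splits.of_splits_map (algebraMap ℝ ℂ) (IsAlgClosed.splits _) fun z hz => ?_
  have hz0 : aeval z (P n) = 0 := by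
    rw [aeval_def, ← eval_map]
    exact isRoot_of_mem_roots hz
  suffices him : z.im = 0 from ⟨z.re, Complex.ext (by simp) (by simp [him])⟩
  by_contra him
  refine h.not_dvd_of_nonneg hΛ (n := n) ?_ (fun x _ => ?_)
    (quadratic_dvd_of_aeval_eq_zero_im_ne_zero (P n) hz0 him)
  · have : (X ^ 2 - C (2 * z.re) * X + C (‖z‖ ^ 2) : ℝ[X]).natDegree = 2 := by compute_degree!
    omega
  · simp only [eval_add, eval_sub, eval_pow, eval_mul, eval_X, eval_C]
    rw [Complex.sq_norm, Complex.normSq_apply]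
    nlinarith [sq_nonneg (x - z.re), sq_nonneg z.im]

lemma card_roots (h : IsOrthonormal Λ P) (hΛ : IsPositiveOn Λ s) (n : ℕ) :
    (P n).roots.toFinset.card = n := by
  rw [Multiset.toFinset_card_of_nodup (h.nodup_roots hΛ n),
    ← (h.splits hΛ n).natDegree_eq_card_roots, h.natDegree_eq]

lemma coeff_X_mul_eq_neg_mul_roots_sum (h : IsOrthonormal Λ P) (hΛ : IsPositiveOn Λ s) (n : ℕ) :
    (X * P n).coeff n = -(P n).leadingCoeff * (P n).roots.sum := by
  have hnext := (h.splits hΛ n).nextCoeff_eq_neg_sum_roots_mul_leadingCoeff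
  cases n with
  | zero => simpa [nextCoeff, h.natDegree_eq, (h.leadingCoeff_pos 0).ne'] using hnext
  | succ n =>
    rw [nextCoeff_of_natDegree_pos (by rw [h.natDegree_eq]; omega), h.natDegree_eq] at hnext
    simpa using hnext

end Roots

/-! ### Gauss quadrature -/

lemma map_eq_map_mod (h : IsOrthonormal Λ P) {N : ℕ} {f : ℝ[X]} (hf : f.degree < (2 * N : ℕ)) :
    Λ f = Λ (f % P N) := by
  suffices hdiv : Λ (f / P N * P N) = 0 by
    conv_lhs => rw [← EuclideanDomain.div_add_mod' f (P N), map_add, hdiv, zero_add]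
  refine h.map_mul_eq_zero ?_
  rcases lt_or_ge f.degree (P N).degree with hlt | hle
  · rw [(Polynomial.div_eq_zero_iff (h.ne_zero N)).2 hlt, degree_zero]
    exact WithBot.bot_lt_coe N
  · rw [← degree_add_div (h.ne_zero N) hle, h.degree_eq, two_mul, Nat.cast_add] at hf
    exact lt_of_add_lt_add_left hf

lemma map_eq_sum_lagrange (h : IsOrthonormal Λ P) {s : Set ℝ} (hΛ : IsPositiveOn Λ s) {N : ℕ}
    {f : ℝ[X]} (hf : f.degree < (2 * N : ℕ)) :
    Λ f = ∑ x ∈ (P N).roots.toFinset,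
      Λ (Lagrange.basis (P N).roots.toFinset id x) * f.eval x := by
  have hinterp : f % P N = Lagrange.interpolate (P N).roots.toFinset id fun x => f.eval x := by
    refine Lagrange.eq_interpolate_of_eval_eq _ Function.injective_id.injOn ?_ fun x hx => ?_
    · rw [h.card_roots hΛ, ← h.degree_eq N]
      exact EuclideanDomain.mod_lt f (h.ne_zero N)
    · have hroot : (P N).eval x = 0 := isRoot_of_mem_roots (Multiset.mem_toFinset.1 hx)
      conv_rhs => rw [← EuclideanDomain.div_add_mod' f (P N)]
      simp [hroot]
  rw [h.map_eq_map_mod hf, hinterp, Lagrange.interpolate_apply, map_sum]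
  exact Finset.sum_congr rfl fun x _ => by rw [← smul_eq_C_mul, map_smul, smul_eq_mul, mul_comm]

theorem exists_gauss_quadrature (h : IsOrthonormal Λ P) {s : Set ℝ} (hΛ : IsPositiveOn Λ s)
    (N : ℕ) : ∃ w : ℝ → ℝ, (∀ x ∈ (P N).roots.toFinset, 0 < w x) ∧ ∀ f : ℝ[X],
      f.degree < (2 * N : ℕ) → Λ f = ∑ x ∈ (P N).roots.toFinset, w x * f.eval x := by
  refine ⟨_, fun x hx => ?_, fun f hf => h.map_eq_sum_lagrange hΛ hf⟩
  set R := (P N).roots.toFinset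
  have hne := Lagrange.basis_ne_zero (Function.injective_id.injOn (s := (R : Set ℝ))) hx
  have hdeg : (Lagrange.basis R id x ^ 2).degree < (2 * N : ℕ) := by
    rw [degree_pow, Lagrange.degree_basis Function.injective_id.injOn hx, h.card_roots hΛ,
      nsmul_eq_mul]
    have := h.card_roots hΛ N ▸ Finset.card_pos.2 ⟨x, hx⟩
    exact_mod_cast (by omega : 2 * (N - 1) < 2 * N)
  have hself : (Lagrange.basis R id x).eval x = 1 :=
    Lagrange.eval_basis_self (v := id) Function.injective_id.injOn hx
  have hother : ∀ y ∈ R, y ≠ x → (Lagrange.basis R id x).eval y = 0 := fun y hy hyx =>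
    Lagrange.eval_basis_of_ne (v := id) hyx.symm hy
  have hsq : Λ (Lagrange.basis R id x ^ 2) = Λ (Lagrange.basis R id x) := by
    rw [h.map_eq_sum_lagrange hΛ hdeg, Finset.sum_eq_single_of_mem x hx fun y hy hyx => by
      simp [hother y hy hyx], eval_pow, hself, one_pow, mul_one]
  exact hsq ▸ hΛ.map_sq_pos hne

section Alternation

variable {s : Set ℝ} {ρ : ℝ[X]} {R : ℕ → ℝ[X]} {N : ℕ}

lemma exists_relation_of_roots (h : IsOrthonormal Λ P) (hΛ : IsPositiveOn Λ s)
    (hR : IsOrthonormal (Λ ∘ₗ LinearMap.mulLeft ℝ ρ) R) (hρ : ρ.natDegree ≤ 2)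
    (hρpos : ∀ x ∈ (P (N + 1)).roots.toFinset, 0 < ρ.eval x) {a b : ℝ}
    (ha : a ∈ (P (N + 1)).roots.toFinset) (hb : b ∈ (P (N + 1)).roots.toFinset) (hab : a ≠ b) :
    ∃ α > 0, ∃ β > 0,
      α * (R N).eval a * ∏ c ∈ ((P (N + 1)).roots.toFinset.erase a).erase b, (a - c) +
        β * (R N).eval b * ∏ c ∈ ((P (N + 1)).roots.toFinset.erase a).erase b, (b - c) = 0 := by
  obtain ⟨w, hw, hgauss⟩ := h.exists_gauss_quadrature hΛ (N + 1)
  have hcard := h.card_roots hΛ (N + 1)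
  set S := (P (N + 1)).roots.toFinset
  set f := Lagrange.nodal ((S.erase a).erase b) id with hf
  have hfdeg : f.natDegree < N := by
    rw [Lagrange.natDegree_nodal, Finset.card_erase_of_mem (Finset.mem_erase.2 ⟨hab.symm, hb⟩),
      Finset.card_erase_of_mem ha, hcard]
    have := hcard ▸ Finset.one_lt_card.2 ⟨a, ha, b, hb, hab⟩
    omega
  have hdeg : (ρ * (f * R N)).degree < (2 * (N + 1) : ℕ) := by
    refine degree_le_natDegree.trans_lt (Nat.cast_lt.2 ?_)
    have := hR.natDegree_eq N
    have := natDegree_mul_le (p := ρ) (q := f * R N)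
    have := natDegree_mul_le (p := f) (q := R N)
    omega
  have hsum : Λ (ρ * (f * R N)) = 0 := hR.map_mul_eq_zero
    (degree_le_natDegree.trans_lt (Nat.cast_lt.2 hfdeg))
  rw [hgauss _ hdeg, Finset.sum_eq_add_of_mem a b ha hb hab] at hsum
  · refine ⟨w a * ρ.eval a, mul_pos (hw a ha) (hρpos a ha), w b * ρ.eval b,
      mul_pos (hw b hb) (hρpos b hb), ?_⟩
    simp only [eval_mul, hf, Lagrange.eval_nodal, id_eq] at hsum
    linear_combination hsum
  · rintro c hc ⟨hca, hcb⟩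
    have hfc : f.eval c = 0 := Lagrange.eval_nodal_at_node (v := id)
      (Finset.mem_erase.2 ⟨hcb, Finset.mem_erase.2 ⟨hca, hc⟩⟩)
    simp [hfc]

lemma eval_ne_zero_of_root (h : IsOrthonormal Λ P) (hΛ : IsPositiveOn Λ s)
    (hR : IsOrthonormal (Λ ∘ₗ LinearMap.mulLeft ℝ ρ) R) (hρ : ρ.natDegree ≤ 2)
    (hρpos : ∀ x ∈ (P (N + 1)).roots.toFinset, 0 < ρ.eval x) {a : ℝ}
    (ha : a ∈ (P (N + 1)).roots.toFinset) : (R N).eval a ≠ 0 := by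
  intro ha0
  refine hR.ne_zero N (eq_zero_of_natDegree_lt_card_of_eval_eq_zero' _
    (P (N + 1)).roots.toFinset (fun b hb => ?_) ?_)
  · rcases eq_or_ne a b with rfl | hab
    · exact ha0
    obtain ⟨α, -, β, hβ, hrel⟩ := h.exists_relation_of_roots hΛ hR hρ hρpos ha hb hab
    have hprod : ∏ c ∈ ((P (N + 1)).roots.toFinset.erase a).erase b, (b - c) ≠ 0 :=
      Finset.prod_ne_zero_iff.2 fun c hc => sub_ne_zero.2 (Finset.ne_of_mem_erase hc).symm
    simpa [ha0, hβ.ne', hprod] using hrel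
  · rw [h.card_roots hΛ, hR.natDegree_eq]
    exact N.lt_succ_self

/-- The weights of Gauss quadrature are positive, so the orthogonality of `R N` to the nodal
polynomial of the remaining zeros is a relation between the values at `a` and `b` alone. -/
lemma eval_mul_eval_neg_of_consecutive_roots (h : IsOrthonormal Λ P) (hΛ : IsPositiveOn Λ s)
    (hR : IsOrthonormal (Λ ∘ₗ LinearMap.mulLeft ℝ ρ) R) (hρ : ρ.natDegree ≤ 2)
    (hρpos : ∀ x ∈ (P (N + 1)).roots.toFinset, 0 < ρ.eval x) {a b : ℝ}
    (ha : a ∈ (P (N + 1)).roots.toFinset) (hb : b ∈ (P (N + 1)).roots.toFinset) (hab : a < b)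
    (hconsec : ∀ c ∈ (P (N + 1)).roots.toFinset, c ≤ a ∨ b ≤ c) :
    (R N).eval a * (R N).eval b < 0 := by
  obtain ⟨α, hα, β, hβ, hrel⟩ := h.exists_relation_of_roots hΛ hR hρ hρpos ha hb hab.ne
  have hRa := h.eval_ne_zero_of_root hΛ hR hρ hρpos ha
  set A := ∏ c ∈ ((P (N + 1)).roots.toFinset.erase a).erase b, (a - c)
  set B := ∏ c ∈ ((P (N + 1)).roots.toFinset.erase a).erase b, (b - c)
  have hAB : 0 < A * B := by
    rw [← Finset.prod_mul_distrib]
    refine Finset.prod_pos fun c hc => ?_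
    simp only [Finset.mem_erase] at hc
    obtain ⟨hcb, hca, hc⟩ := hc
    rcases hconsec c hc with hle | hle
    · have hlt := hle.lt_of_ne hca
      exact mul_pos (sub_pos.2 hlt) (sub_pos.2 (hlt.trans hab))
    · have hlt := hle.lt_of_ne hcb.symm
      exact mul_pos_of_neg_of_neg (sub_neg.2 (hab.trans hlt)) (sub_neg.2 hlt)
  have hA : A ≠ 0 := left_ne_zero_of_mul hAB.ne'
  have hscaled : β * (A * B) * ((R N).eval a * (R N).eval b) = -(α * ((R N).eval a * A) ^ 2) := by
    linear_combination ((R N).eval a * A) * hrel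
  have hneg : β * (A * B) * ((R N).eval a * (R N).eval b) < 0 := by
    rw [hscaled, neg_lt_zero]
    positivity
  exact neg_of_mul_neg_right hneg (by positivity)

end Alternation

end IsOrthonormal

/-! ### Polynomials with positive zeros -/

lemma abs_prod_sub_lt_abs_prod_neg_sub {x : ℝ} (hx : 0 < x) {s : Multiset ℝ} (hs : s ≠ 0)
    (hpos : ∀ a ∈ s, 0 < a) :
    |(s.map fun a => x - a).prod| < |(s.map fun a => -x - a).prod| := by
  induction s using Multiset.induction with
  | empty => exact absurd rfl hs
  | cons a s ih =>
    have ha : |x - a| < |-x - a| := by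
      rw [← sq_lt_sq]
      nlinarith [hpos a (s.mem_cons_self a)]
    simp only [Multiset.map_cons, Multiset.prod_cons, abs_mul]
    rcases eq_or_ne s 0 with rfl | hs
    · simpa using ha
    · exact mul_lt_mul'' ha (ih hs fun b hb => hpos b (Multiset.mem_cons_of_mem hb))
        (abs_nonneg _) (abs_nonneg _)

lemma abs_eval_lt_abs_eval_neg {p : ℝ[X]} (hp : p.Splits) (hdeg : 0 < p.natDegree)
    (hroots : ∀ a ∈ p.roots, 0 < a) {x : ℝ} (hx : 0 < x) : |p.eval x| < |p.eval (-x)| := by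
  rw [hp.eval_eq_prod_roots, hp.eval_eq_prod_roots (-x), abs_mul, abs_mul]
  refine mul_lt_mul_of_pos_left (abs_prod_sub_lt_abs_prod_neg_sub hx ?_ hroots) ?_
  · rw [← Multiset.card_pos, ← hp.natDegree_eq_card_roots]
    exact hdeg
  · rw [abs_pos, leadingCoeff_ne_zero]
    rintro rfl
    simp at hdeg

lemma eval_neg_mul_eval_neg_pos {p : ℝ[X]} (hp : p.Splits) (hp0 : p ≠ 0)
    (hroots : ∀ a ∈ p.roots, 0 < a) {x y : ℝ} (hx : 0 < x) (hy : 0 < y) :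
    0 < p.eval (-x) * p.eval (-y) := by
  have hprod : 0 < (p.roots.map fun a => (-x - a) * (-y - a)).prod := by
    refine Multiset.prod_induction (0 < ·) _ (fun _ _ => mul_pos) one_pos fun c hc => ?_
    obtain ⟨a, ha, rfl⟩ := Multiset.mem_map.1 hc
    have := hroots a ha
    exact mul_pos_of_neg_of_neg (by linarith) (by linarith)
  rw [hp.eval_eq_prod_roots, hp.eval_eq_prod_roots (-y), mul_mul_mul_comm,
    ← Multiset.prod_map_mul]
  exact mul_pos (mul_self_pos.2 (leadingCoeff_ne_zero.2 hp0)) hprod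

/-! ### The Gram-Schmidt process -/

section GramSchmidt

variable {Λ : ℝ[X] →ₗ[ℝ] ℝ} {P q : ℕ → ℝ[X]}

lemma degree_sum_smul_lt {n : ℕ} (hP : ∀ k < n, (P k).degree = k) (a : ℕ → ℝ) :
    (∑ k ∈ Finset.range n, a k • P k).degree < n := by
  refine (degree_sum_le _ _).trans_lt ((Finset.sup_lt_iff (WithBot.bot_lt_coe n)).2 fun k hk => ?_)
  have hk := Finset.mem_range.1 hk
  exact (degree_smul_le _ _).trans_lt ((hP k hk).trans_lt (Nat.cast_lt.2 hk))

lemma degree_gramSchmidt {c : ℕ → ℝ} (hc : ∀ n, (q n).Monic → c n ≠ 0) {a : ℕ → ℕ → ℝ}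
    (hq : ∀ n, q n = X ^ n - ∑ k ∈ Finset.range n, a n k • P k) (hP : ∀ n, P n = c n • q n)
    (n : ℕ) : (q n).Monic ∧ (P n).degree = n := by
  induction n using Nat.strong_induction_on with
  | _ n ih =>
    have hdeg := degree_sum_smul_lt (fun k hk => (ih k hk).2) (a n)
    have hmonic : (q n).Monic := hq n ▸ monic_X_pow_sub hdeg
    refine ⟨hmonic, ?_⟩
    rw [hP, smul_eq_C_mul, degree_C_mul (hc n hmonic), hq,
      degree_sub_eq_left_of_degree_lt (by rwa [degree_X_pow]), degree_X_pow]

lemma map_gramSchmidt_mul_eq_zero {c : ℕ → ℝ}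
    (hq : ∀ n, q n = X ^ n - ∑ k ∈ Finset.range n, Λ (X ^ n * P k) • P k)
    (hP : ∀ n, P n = c n • q n) (hnorm : ∀ n, Λ (P n * P n) = 1) {k n : ℕ} (hkn : k < n) :
    Λ (P n * P k) = 0 := by
  induction n using Nat.strong_induction_on generalizing k with
  | _ n ih =>
    have horth : ∀ j < n, Λ (P j * P k) = if j = k then 1 else 0 := by
      intro j hj
      rcases lt_trichotomy j k with hlt | rfl | hlt
      · rw [mul_comm, ih k hkn hlt, if_neg hlt.ne]
      · rw [hnorm, if_pos rfl]
      · rw [ih j hj hlt, if_neg hlt.ne']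
    have hsum : ∑ j ∈ Finset.range n, Λ (X ^ n * P j) * Λ (P j * P k) = Λ (X ^ n * P k) := by
      rw [Finset.sum_congr rfl fun j hj => by rw [horth j (Finset.mem_range.1 hj)]]
      simp [hkn]
    rw [hP n, smul_mul_assoc, map_smul, hq, sub_mul, map_sub, Finset.sum_mul, map_sum]
    simp only [smul_mul_assoc, map_smul, smul_eq_mul, hsum, sub_self, mul_zero]

lemma isOrthonormal_of_gramSchmidt {s : Set ℝ} (hΛ : IsPositiveOn Λ s)
    (hq : ∀ n, q n = X ^ n - ∑ k ∈ Finset.range n, Λ (X ^ n * P k) • P k)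
    (hP : ∀ n, P n = (Real.sqrt (Λ (q n * q n)))⁻¹ • q n) : IsOrthonormal Λ P := by
  have hnorm_pos : ∀ n, (q n).Monic → 0 < Λ (q n * q n) := fun n hmonic => by
    rw [← sq]
    exact hΛ.map_sq_pos hmonic.ne_zero
  have hmonic := degree_gramSchmidt (fun n hn => (inv_pos.2 (Real.sqrt_pos.2 (hnorm_pos n hn))).ne')
    hq hP
  have hnorm : ∀ n, Λ (P n * P n) = 1 := fun n => by
    have hpos := hnorm_pos n (hmonic n).1
    rw [hP, smul_mul_smul_comm, map_smul, smul_eq_mul, ← mul_inv, Real.mul_self_sqrt hpos.le,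
      inv_mul_cancel₀ hpos.ne']
  refine ⟨fun n => (hmonic n).2, fun n => ?_, fun m n => ?_⟩
  · rw [hP, smul_eq_C_mul, leadingCoeff_mul, leadingCoeff_C, (hmonic n).1.leadingCoeff, mul_one]
    exact inv_pos.2 (Real.sqrt_pos.2 (hnorm_pos n (hmonic n).1))
  · rcases lt_trichotomy m n with hlt | rfl | hlt
    · rw [mul_comm, map_gramSchmidt_mul_eq_zero hq hP hnorm hlt, if_neg hlt.ne]
    · rw [hnorm, if_pos rfl]
    · rw [map_gramSchmidt_mul_eq_zero hq hP hnorm hlt, if_neg hlt.ne']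

end GramSchmidt

/-! ### The polynomials `P_n^{(ℓ)}` -/

/-- The orthogonal polynomials before normalization. -/
def preOrthPoly (ℓ : Fin 2) (ζ : ℝ) (n : ℕ) : ℝ[X] :=
  X ^ n - ∑ k ∈ Finset.range n, C (wip ℓ ζ (X ^ n) (orthPoly ℓ ζ k)) * orthPoly ℓ ζ k

lemma orthPoly_eq_C_mul_preOrthPoly (ℓ : Fin 2) (ζ : ℝ) (n : ℕ) : orthPoly ℓ ζ n =
    C (Real.sqrt (wip ℓ ζ (preOrthPoly ℓ ζ n) (preOrthPoly ℓ ζ n)))⁻¹ * preOrthPoly ℓ ζ n := by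
  rw [orthPoly, preOrthPoly, Finset.sum_range]

section

variable {ζ : ℝ} (hζ : 0 < ζ)

include hζ

lemma isPositiveOn_weightFun (ℓ : Fin 2) : IsPositiveOn (weightFun ℓ ζ) (Set.Ici 1) := by
  intro f hf hnonneg
  have hX : (X ^ 2 - 1 : ℝ[X]) ≠ 0 := (monic_X_pow_sub_C 1 two_ne_zero).ne_zero
  rw [weightFun_apply, weightFun_zero_apply]
  refine mul_pos (inv_pos.2 (expMom_X_pos hζ))
    (expMom_pos hζ (mul_ne_zero (pow_ne_zero _ hX) hf) fun x hx => ?_)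
  simp only [eval_mul, eval_pow, eval_sub, eval_X, eval_one]
  exact mul_nonneg (pow_nonneg (by nlinarith) _) (hnonneg x hx)

lemma isOrthonormal_orthPoly (ℓ : Fin 2) : IsOrthonormal (weightFun ℓ ζ) (orthPoly ℓ ζ) :=
  isOrthonormal_of_gramSchmidt (isPositiveOn_weightFun hζ ℓ) (q := preOrthPoly ℓ ζ)
    (fun n => by simp only [preOrthPoly, wip_eq_weightFun ℓ hζ, smul_eq_C_mul])
    (fun n => by rw [← wip_eq_weightFun ℓ hζ, smul_eq_C_mul, orthPoly_eq_C_mul_preOrthPoly])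

end

/-! ### Zeros of even polynomials -/

lemma eval_neg_of_comp_neg_X {p : ℝ[X]} (heven : p.comp (-X) = p) (x : ℝ) :
    p.eval (-x) = p.eval x := by
  conv_rhs => rw [← heven]
  simp

lemma natDegree_le_of_comp_neg_X {p : ℝ[X]} (heven : p.comp (-X) = p) {M : ℕ}
    (hdeg : p.natDegree ≤ 2 * M + 1) : p.natDegree ≤ 2 * M := by
  by_contra! hlt
  have hdeg_eq : p.natDegree = 2 * M + 1 := le_antisymm hdeg hlt
  have hlead := comp_neg_X_leadingCoeff_eq p
  rw [heven, hdeg_eq, Odd.neg_one_pow ⟨M, rfl⟩] at hlead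
  have hp : p = 0 := leadingCoeff_eq_zero.1 (by linarith)
  simp [hp] at hlt

lemma exists_strictMono_roots_of_sign_changes {p : ℝ[X]} {M : ℕ} {x : Fin (M + 1) → ℝ}
    (hx : StrictMono x) (hsign : ∀ k : Fin M, p.eval (x k.castSucc) * p.eval (x k.succ) < 0) :
    ∃ w : Fin M → ℝ, StrictMono w ∧ (∀ k, x 0 < w k) ∧ ∀ k, p.IsRoot (w k) := by
  have hroot : ∀ k : Fin M, ∃ t ∈ Set.Ioo (x k.castSucc) (x k.succ), p.eval t = 0 := by
    intro k
    have hle := (hx k.castSucc_lt_succ).le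
    rcases mul_neg_iff.1 (hsign k) with ⟨h1, h2⟩ | ⟨h1, h2⟩
    · exact intermediate_value_Ioo' hle p.continuousOn ⟨h2, h1⟩
    · exact intermediate_value_Ioo hle p.continuousOn ⟨h1, h2⟩
  choose w hw hw0 using hroot
  exact ⟨w, fun i j hij => (hw i).2.trans_le ((hx.monotone hij).trans (hw j).1.le),
    fun k => (hx.monotone (Fin.zero_le _)).trans_lt (hw k).1, hw0⟩

lemma isRoot_iff_of_comp_neg_X {p : ℝ[X]} (heven : p.comp (-X) = p) (hp : p ≠ 0) {M : ℕ}
    (hdeg : p.natDegree ≤ 2 * M) {w : Fin M → ℝ} (hw : Function.Injective w)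
    (hpos : ∀ k, 0 < w k) (hroot : ∀ k, p.IsRoot (w k)) (t : ℝ) :
    p.IsRoot t ↔ ∃ k, t = w k ∨ t = -w k := by
  have hneg : ∀ k, p.IsRoot (-w k) := fun k => (eval_neg_of_comp_neg_X heven _).trans (hroot k)
  refine ⟨fun ht => ?_, ?_⟩
  · set S := Finset.univ.image (Sum.elim w (-w)) with hS
    have hinj : Function.Injective (Sum.elim w (-w)) :=
      hw.sumElim (neg_injective.comp hw) fun i j => by
        have := hpos i
        have := hpos j
        simp only [Pi.neg_apply]
        linarith
    have hcard : S.card = 2 * M := by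
      simp [hS, Finset.card_image_of_injective _ hinj, two_mul]
    have hsub : S ⊆ p.roots.toFinset := by
      simp only [hS, Finset.image_subset_iff, Multiset.mem_toFinset, mem_roots hp]
      rintro (k | k) -
      exacts [hroot k, hneg k]
    have hS_eq := Finset.eq_of_subset_of_card_le hsub
      ((Multiset.toFinset_card_le _).trans ((card_roots' p).trans (hcard ▸ hdeg)))
    have htS : t ∈ S := hS_eq ▸ Multiset.mem_toFinset.2 ((mem_roots hp).2 ht)
    obtain ⟨k | k, -, rfl⟩ := Finset.mem_image.1 htS
    exacts [⟨k, .inl rfl⟩, ⟨k, .inr rfl⟩]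
  · rintro ⟨k, rfl | rfl⟩
    exacts [hroot k, hneg k]

/-! ### The zeros of `Q_{2M}` -/

/-- `Q_{2M}` as a polynomial. -/
def polyQPoly (M : ℕ) (ζ : ℝ) : ℝ[X] :=
  orthPoly 0 ζ (M + 1) * (orthPoly 1 ζ M).comp (-X)
    + (orthPoly 0 ζ (M + 1)).comp (-X) * orthPoly 1 ζ M

lemma eval_polyQPoly (M : ℕ) (ζ x : ℝ) : (polyQPoly M ζ).eval x = polyQ M ζ x := by
  simp [polyQPoly, polyQ]

lemma polyQPoly_comp_neg_X (M : ℕ) (ζ : ℝ) : (polyQPoly M ζ).comp (-X) = polyQPoly M ζ := by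
  simp only [polyQPoly, add_comp, mul_comp, comp_neg_X_comp_neg_X]
  ring

section

variable {ζ : ℝ} (hζ : 0 < ζ)

include hζ

lemma natDegree_polyQPoly_le (M : ℕ) : (polyQPoly M ζ).natDegree ≤ 2 * M := by
  refine natDegree_le_of_comp_neg_X (polyQPoly_comp_neg_X M ζ) ?_
  have h0 := (isOrthonormal_orthPoly hζ 0).natDegree_eq (M + 1)
  have h1 := (isOrthonormal_orthPoly hζ 1).natDegree_eq M
  refine (natDegree_add_le _ _).trans (max_le ?_ ?_) <;>
    refine natDegree_mul_le.trans ?_ <;>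
    simp only [natDegree_comp, natDegree_neg, natDegree_X, h0, h1] <;> omega

lemma orthPoly_roots_pos (ℓ : Fin 2) (n : ℕ) {a : ℝ} (ha : a ∈ (orthPoly ℓ ζ n).roots) : 1 < a :=
  (isOrthonormal_orthPoly hζ ℓ).lt_of_isRoot (isPositiveOn_weightFun hζ ℓ) (isRoot_of_mem_roots ha)

lemma isOrthonormal_orthPoly_one :
    IsOrthonormal (weightFun 0 ζ ∘ₗ LinearMap.mulLeft ℝ (X ^ 2 - 1)) (orthPoly 1 ζ) := by
  convert isOrthonormal_orthPoly hζ 1 using 1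
  exact LinearMap.ext fun f => (weightFun_one_apply ζ f).symm

section node

variable {M : ℕ} {a b : ℝ} (ha : a ∈ (orthPoly 0 ζ (M + 1)).roots.toFinset)

include ha

lemma one_lt_node : 1 < a := orthPoly_roots_pos hζ 0 _ (Multiset.mem_toFinset.1 ha)

lemma eval_sq_sub_one_pos_of_node : 0 < (X ^ 2 - 1 : ℝ[X]).eval a := by
  simpa using one_lt_pow₀ (one_lt_node hζ ha) two_ne_zero

omit hζ in
lemma eval_polyQPoly_node : (polyQPoly M ζ).eval a =
    (orthPoly 0 ζ (M + 1)).eval (-a) * (orthPoly 1 ζ M).eval a := by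
  have hroot : (orthPoly 0 ζ (M + 1)).eval a = 0 := isRoot_of_mem_roots (Multiset.mem_toFinset.1 ha)
  rw [eval_polyQPoly, polyQ, hroot, zero_mul, zero_add]

lemma eval_neg_node_mul_eval_neg_node_pos (hb : b ∈ (orthPoly 0 ζ (M + 1)).roots.toFinset) :
    0 < (orthPoly 0 ζ (M + 1)).eval (-a) * (orthPoly 0 ζ (M + 1)).eval (-b) :=
  have hP := isOrthonormal_orthPoly hζ 0
  eval_neg_mul_eval_neg_pos (hP.splits (isPositiveOn_weightFun hζ 0) (M + 1)) (hP.ne_zero _)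
    (fun _ hx => one_pos.trans (orthPoly_roots_pos hζ 0 _ hx))
    (one_pos.trans (one_lt_node hζ ha)) (one_pos.trans (one_lt_node hζ hb))

lemma eval_polyQPoly_node_ne_zero : (polyQPoly M ζ).eval a ≠ 0 := by
  rw [eval_polyQPoly_node ha]
  exact mul_ne_zero (mul_self_pos.1 (eval_neg_node_mul_eval_neg_node_pos hζ ha ha))
    ((isOrthonormal_orthPoly hζ 0).eval_ne_zero_of_root (isPositiveOn_weightFun hζ 0)
      (isOrthonormal_orthPoly_one hζ) natDegree_X_pow_sub_C.le
      (fun _ => eval_sq_sub_one_pos_of_node hζ) ha)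

lemma polyQPoly_sign_change (hb : b ∈ (orthPoly 0 ζ (M + 1)).roots.toFinset) (hab : a < b)
    (hconsec : ∀ c ∈ (orthPoly 0 ζ (M + 1)).roots.toFinset, c ≤ a ∨ b ≤ c) :
    (polyQPoly M ζ).eval a * (polyQPoly M ζ).eval b < 0 := by
  rw [eval_polyQPoly_node ha, eval_polyQPoly_node hb, mul_mul_mul_comm]
  exact mul_neg_of_pos_of_neg (eval_neg_node_mul_eval_neg_node_pos hζ ha hb)
    ((isOrthonormal_orthPoly hζ 0).eval_mul_eval_neg_of_consecutive_roots
      (isPositiveOn_weightFun hζ 0) (isOrthonormal_orthPoly_one hζ) natDegree_X_pow_sub_C.le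
      (fun _ => eval_sq_sub_one_pos_of_node hζ) ha hb hab hconsec)

end node

lemma exists_strictMono_zeros_polyQ (M : ℕ) : ∃ w : Fin M → ℝ, StrictMono w ∧ (∀ k, 1 < w k) ∧
    ∀ x : ℝ, polyQ M ζ x = 0 ↔ ∃ k, x = w k ∨ x = -w k := by
  set S := (orthPoly 0 ζ (M + 1)).roots.toFinset
  have hcard : S.card = M + 1 :=
    (isOrthonormal_orthPoly hζ 0).card_roots (isPositiveOn_weightFun hζ 0) (M + 1)
  set x := S.orderEmbOfFin hcard
  have hx : ∀ j, x j ∈ S := S.orderEmbOfFin_mem hcard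
  obtain ⟨w, hmono, hlt, hroot⟩ := exists_strictMono_roots_of_sign_changes (p := polyQPoly M ζ)
    x.strictMono fun k => polyQPoly_sign_change hζ (hx _) (hx _)
      (x.strictMono k.castSucc_lt_succ) fun c hc => by
        obtain ⟨j, rfl⟩ : ∃ j, x j = c := by
          rwa [← Set.mem_range, Finset.range_orderEmbOfFin]
        exact (le_or_gt j k.castSucc).imp (x.monotone ·) fun h =>
          x.monotone (Fin.castSucc_lt_iff_succ_le.1 h)
  have hone : ∀ k, 1 < w k := fun k => (one_lt_node hζ (hx 0)).trans (hlt k)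
  have hne : polyQPoly M ζ ≠ 0 := fun h0 => eval_polyQPoly_node_ne_zero hζ (hx 0) (by
    rw [h0, eval_zero])
  refine ⟨w, hmono, hone, fun t => ?_⟩
  rw [← eval_polyQPoly]
  exact isRoot_iff_of_comp_neg_X (polyQPoly_comp_neg_X M ζ) hne (natDegree_polyQPoly_le hζ M)
    hmono.injective (fun k => one_pos.trans (hone k)) hroot t

omit hζ in
lemma exists_odd_extension {M : ℕ} (w : Fin M → ℝ) :
    ∃ z : ℤ → ℝ, (∀ i, z (-i) = -z i) ∧ ∀ k : Fin M, z (k + 1) = w k := by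
  refine ⟨fun i => i.sign * if h : i.natAbs - 1 < M then w ⟨i.natAbs - 1, h⟩ else 0,
    fun i => by simp only [Int.sign_neg, Int.natAbs_neg, Int.cast_neg, neg_mul], fun k => ?_⟩
  have hsign : ((k : ℤ) + 1).sign = 1 := Int.sign_eq_one_of_pos (by positivity)
  have hindex : ((k : ℤ) + 1).natAbs - 1 = k := by omega
  simp [hsign, hindex]

lemma exists_isZeroList (M : ℕ) : ∃ z : ℤ → ℝ, IsZeroList M ζ z := by
  obtain ⟨w, hmono, hlt, hzeros⟩ := exists_strictMono_zeros_polyQ hζ M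
  obtain ⟨z, hodd, hz⟩ := exists_odd_extension w
  have hIcc : ∀ i : ℤ, 1 ≤ i → i ≤ M → ∃ k : Fin M, i = k + 1 := fun i h1 hM =>
    ⟨⟨(i - 1).toNat, by omega⟩, by simp only; omega⟩
  refine ⟨z, hodd, ?_, ?_, fun x => (hzeros x).trans ⟨?_, ?_⟩⟩
  · rintro i ⟨h1, hM⟩
    obtain ⟨k, rfl⟩ := hIcc i h1 hM
    exact hz k ▸ hlt k
  · rintro i ⟨hi1, hiM⟩ j ⟨hj1, hjM⟩ hij
    obtain ⟨k, rfl⟩ := hIcc i hi1 hiM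
    obtain ⟨l, rfl⟩ := hIcc j hj1 hjM
    rw [hz, hz]
    exact hmono (by omega)
  · rintro ⟨k, rfl | rfl⟩
    · exact ⟨k + 1, ⟨by omega, by omega⟩, by omega, (hz k).symm⟩
    · exact ⟨-(k + 1), ⟨by omega, by omega⟩, by omega, by rw [hodd, hz]⟩
  · rintro ⟨i, ⟨hi1, hiM⟩, hi0, rfl⟩
    rcases lt_or_gt_of_ne hi0 with hneg | hpos
    · obtain ⟨k, hk⟩ := hIcc (-i) (by omega) (by omega)
      exact ⟨k, .inr (by rw [← hz, ← hk, hodd, neg_neg])⟩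
    · obtain ⟨k, rfl⟩ := hIcc i (by omega) hiM
      exact ⟨k, .inl (hz k)⟩

end

/-! ### The coordinate ring of the mass shell -/

/-- The ring `ℝ[x, n] / (n² - (x² - 1))`, whose element `⟨f, g⟩` is `f(x) + n g(x)`. On the mass
shell `x` is the energy `E` and `n` is `(U⁰)⁻¹ p_{<1>}`. -/
abbrev ShellPoly : Type := QuadraticAlgebra ℝ[X] (X ^ 2 - 1) 0

/-- The value of `f(x) + n g(x)` at a pair `(x, n)` of real numbers; it is multiplicative only if
`n² = x² - 1`. -/
def shellEval (x n : ℝ) : ShellPoly →ₗ[ℝ] ℝ where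
  toFun v := v.re.eval x + n * v.im.eval x
  map_add' v w := by simp only [QuadraticAlgebra.re_add, QuadraticAlgebra.im_add, eval_add]; ring
  map_smul' c v := by
    simp only [QuadraticAlgebra.re_smul, QuadraticAlgebra.im_smul, eval_smul, smul_eq_mul,
      RingHom.id_apply]
    ring

lemma shellEval_apply (x n : ℝ) (v : ShellPoly) :
    shellEval x n v = v.re.eval x + n * v.im.eval x := rfl

lemma shellEval_mul {x n : ℝ} (h : n ^ 2 = x ^ 2 - 1) (v w : ShellPoly) :
    shellEval x n (v * w) = shellEval x n v * shellEval x n w := by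
  simp only [shellEval_apply, QuadraticAlgebra.re_mul, QuadraticAlgebra.im_mul, eval_add, eval_mul,
    eval_sub, eval_pow, eval_X, eval_one, eval_zero]
  linear_combination (-(eval x v.im * eval x w.im)) * h

/-- Integration over the mass shell against the equilibrium distribution. The contribution of
`n g(x)` vanishes because `n` is odd under reflection of the momentum. -/
def shellFun (ζ : ℝ) : ShellPoly →ₗ[ℝ] ℝ where
  toFun v := weightFun 0 ζ v.re
  map_add' v w := by rw [QuadraticAlgebra.re_add, map_add]
  map_smul' c v := by rw [QuadraticAlgebra.re_smul, map_smul, RingHom.id_apply]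

lemma shellFun_apply (ζ : ℝ) (v : ShellPoly) : shellFun ζ v = weightFun 0 ζ v.re := rfl

lemma shellFun_mul (ζ : ℝ) (v w : ShellPoly) :
    shellFun ζ (v * w) = weightFun 0 ζ (v.re * w.re) + weightFun 1 ζ (v.im * w.im) := by
  rw [shellFun_apply, QuadraticAlgebra.re_mul, map_add, weightFun_one_apply, mul_assoc]

/-- The basis of `ShellPoly` formed by the `P_k^{(0)}(x)` and the `n P_k^{(1)}(x)`, up to the
degrees used in order `M`. -/
def shellBasis (M : ℕ) (ζ : ℝ) : Blk M → ShellPoly :=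
  Sum.elim (fun k => ⟨orthPoly 0 ζ k, 0⟩) (fun k => ⟨0, orthPoly 1 ζ k⟩)

lemma shellBasis_inl {M : ℕ} (ζ : ℝ) (k : Fin (M + 1)) :
    shellBasis M ζ (.inl k) = ⟨orthPoly 0 ζ k, 0⟩ := rfl

lemma shellBasis_inr {M : ℕ} (ζ : ℝ) (k : Fin M) :
    shellBasis M ζ (.inr k) = ⟨0, orthPoly 1 ζ k⟩ := rfl

/-- The functions of order `M`: the span of `shellBasis M ζ`, for every `ζ > 0`. -/
def shellSpace (M : ℕ) : Submodule ℝ ShellPoly where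
  carrier := {v | v.re.degree < (M + 1 : ℕ) ∧ v.im.degree < M}
  add_mem' hv hw := ⟨(degree_add_le _ _).trans_lt (max_lt hv.1 hw.1),
    (degree_add_le _ _).trans_lt (max_lt hv.2 hw.2)⟩
  zero_mem' := by simp
  smul_mem' c v hv := ⟨(degree_smul_le c v.re).trans_lt hv.1, (degree_smul_le c v.im).trans_lt hv.2⟩

lemma re_finsetSum {ι : Type*} (s : Finset ι) (v : ι → ShellPoly) :
    (∑ i ∈ s, v i).re = ∑ i ∈ s, (v i).re :=
  map_sum (QuadraticAlgebra.reₗ _ _) v s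

lemma im_finsetSum {ι : Type*} (s : Finset ι) (v : ι → ShellPoly) :
    (∑ i ∈ s, v i).im = ∑ i ∈ s, (v i).im :=
  map_sum (QuadraticAlgebra.imₗ _ _) v s

lemma mem_shellSpace {M : ℕ} {v : ShellPoly} :
    v ∈ shellSpace M ↔ v.re.degree < (M + 1 : ℕ) ∧ v.im.degree < M := Iff.rfl

section

variable {ζ : ℝ} (hζ : 0 < ζ) {M : ℕ}

include hζ

lemma shellFun_shellBasis_mul_shellBasis (b b' : Blk M) :
    shellFun ζ (shellBasis M ζ b * shellBasis M ζ b') = if b = b' then 1 else 0 := by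
  have h0 := (isOrthonormal_orthPoly hζ 0).map_mul
  have h1 := (isOrthonormal_orthPoly hζ 1).map_mul
  rw [shellFun_mul]
  rcases b with i | i <;> rcases b' with j | j <;>
    simp [shellBasis_inl, shellBasis_inr, h0, h1, Fin.ext_iff]

lemma shellBasis_mem_shellSpace (b : Blk M) : shellBasis M ζ b ∈ shellSpace M := by
  have h0 := (isOrthonormal_orthPoly hζ 0).degree_eq
  have h1 := (isOrthonormal_orthPoly hζ 1).degree_eq
  rcases b with k | k <;>
    simp only [mem_shellSpace, shellBasis_inl, shellBasis_inr, h0, h1, degree_zero,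
      WithBot.bot_lt_natCast, Nat.cast_lt, k.is_lt, and_self]

lemma shellSpace_expansion {v : ShellPoly} (hv : v ∈ shellSpace M) :
    v = ∑ b, shellFun ζ (v * shellBasis M ζ b) • shellBasis M ζ b := by
  have hre := (isOrthonormal_orthPoly hζ 0).expansion hv.1
  have him := (isOrthonormal_orthPoly hζ 1).expansion hv.2
  rw [Finset.sum_range] at hre him
  ext1
  · conv_lhs => rw [hre]
    simp [re_finsetSum, shellFun_mul, shellBasis_inl, shellBasis_inr]
  · conv_lhs => rw [him]
    simp [im_finsetSum, shellFun_mul, shellBasis_inl, shellBasis_inr]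

lemma map_eq_sum_shellBasis (L : ShellPoly →ₗ[ℝ] ℝ) {v : ShellPoly} (hv : v ∈ shellSpace M) :
    L v = ∑ b, shellFun ζ (v * shellBasis M ζ b) * L (shellBasis M ζ b) := by
  conv_lhs => rw [shellSpace_expansion hζ hv]
  simp only [map_sum, map_smul, smul_eq_mul]

lemma shellFun_sum_smul_mul_shellBasis (y : Blk M → ℝ) (b : Blk M) :
    shellFun ζ ((∑ b', y b' • shellBasis M ζ b') * shellBasis M ζ b) = y b := by
  simp only [Finset.sum_mul, map_sum, smul_mul_assoc, map_smul,
    shellFun_shellBasis_mul_shellBasis hζ, smul_eq_mul, mul_ite, mul_one, mul_zero,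
    Finset.sum_ite_eq', Finset.mem_univ, if_true]

end

/-! ### The matrices as Gram matrices -/

section

variable {ζ : ℝ} (hζ : 0 < ζ)

include hζ

lemma jacobiMat_apply (ℓ : Fin 2) (N : ℕ) (i j : Fin N) :
    jacobiMat ℓ ζ N i j = weightFun ℓ ζ (X * orthPoly ℓ ζ i * orthPoly ℓ ζ j) := by
  have h := isOrthonormal_orthPoly hζ ℓ
  have hcomm : ∀ f g : ℝ[X], X * f * g = X * g * f := fun f g => mul_right_comm X f g
  have hzero : ∀ {i j : ℕ}, i + 1 < j →
      weightFun ℓ ζ (X * orthPoly ℓ ζ i * orthPoly ℓ ζ j) = 0 := fun {i j} hij =>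
    h.map_mul_eq_zero (by
      rw [degree_mul, degree_X, h.degree_eq, add_comm]
      exact_mod_cast hij)
  simp only [jacobiMat, coefA, coefB, wip_eq_weightFun ℓ hζ]
  split_ifs with h1 h2 h3
  · rw [h1]
  · rw [h2]
  · rw [h3, hcomm]
  · rcases lt_or_gt_of_ne h1 with hlt | hlt
    · rw [hzero (by omega)]
    · rw [hcomm, hzero (by omega)]

lemma natDegree_X_sq_sub_one_mul_orthPoly (n : ℕ) :
    ((X ^ 2 - 1) * orthPoly 1 ζ n).natDegree = n + 2 := by
  have h2 : (X ^ 2 - 1 : ℝ[X]).natDegree = 2 := natDegree_X_pow_sub_C (n := 2) (r := (1 : ℝ))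
  have hX : (X ^ 2 - 1 : ℝ[X]) ≠ 0 := (monic_X_pow_sub_C 1 two_ne_zero).ne_zero
  have h1 := isOrthonormal_orthPoly hζ 1
  rw [natDegree_mul hX (h1.ne_zero n), h2, h1.natDegree_eq, add_comm]

lemma coeff_X_sq_sub_one_mul_orthPoly (n : ℕ) :
    ((X ^ 2 - 1) * orthPoly 1 ζ n).coeff (n + 2) = lc 1 ζ n := by
  have h1 := isOrthonormal_orthPoly hζ 1
  rw [sub_mul, one_mul, coeff_sub, coeff_X_pow_mul, h1.coeff_self,
    coeff_eq_zero_of_natDegree_lt (p := orthPoly 1 ζ n) (by rw [h1.natDegree_eq]; omega), sub_zero,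
    lc]

lemma coeff_succ_X_sq_sub_one_mul_orthPoly (n : ℕ) :
    ((X ^ 2 - 1) * orthPoly 1 ζ n).coeff (n + 1) = -lc 1 ζ n * zeroSum 1 ζ n := by
  have h1 := isOrthonormal_orthPoly hζ 1
  have hX : (X ^ 2 - 1) * orthPoly 1 ζ n = X * (X * orthPoly 1 ζ n) - orthPoly 1 ζ n := by ring
  rw [hX, coeff_sub, coeff_X_mul, h1.coeff_X_mul_eq_neg_mul_roots_sum (isPositiveOn_weightFun hζ 1),
    coeff_eq_zero_of_natDegree_lt (p := orthPoly 1 ζ n) (by rw [h1.natDegree_eq]; omega), sub_zero,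
    lc, zeroSum]

lemma coefP_eq_weightFun (n : ℕ) :
    coefP ζ n = weightFun 1 ζ (orthPoly 0 ζ n * orthPoly 1 ζ n) := by
  have h0 := isOrthonormal_orthPoly hζ 0
  rw [(isOrthonormal_orthPoly hζ 1).map_mul_eq_coeff_div (h0.natDegree_eq n).le, h0.coeff_self,
    coefP, lc, lc]

omit hζ in
lemma weightFun_one_mul (f : ℝ[X]) (n : ℕ) :
    weightFun 1 ζ (f * orthPoly 1 ζ n) = weightFun 0 ζ ((X ^ 2 - 1) * orthPoly 1 ζ n * f) := by
  rw [weightFun_one_apply, mul_assoc, mul_comm f]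

lemma coefQ_eq_weightFun (n : ℕ) :
    coefQ ζ n = weightFun 1 ζ (orthPoly 0 ζ (n + 1) * orthPoly 1 ζ n) := by
  have h0 := isOrthonormal_orthPoly hζ 0
  have hsub := h0.coeff_X_mul_eq_neg_mul_roots_sum (isPositiveOn_weightFun hζ 0) (n + 2)
  have hlc : lc 0 ζ (n + 2) ≠ 0 := (h0.leadingCoeff_pos _).ne'
  rw [weightFun_one_mul, h0.map_mul_eq_of_natDegree_le_succ
    (natDegree_X_sq_sub_one_mul_orthPoly hζ n).le, coeff_X_sq_sub_one_mul_orthPoly hζ,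
    coeff_succ_X_sq_sub_one_mul_orthPoly hζ, ← coeff_X_mul (orthPoly 0 ζ (n + 2)), hsub, coefQ]
  change _ = (_ - _ / lc 0 ζ (n + 2) * (-lc 0 ζ (n + 2) * zeroSum 0 ζ (n + 2))) / lc 0 ζ (n + 1)
  field_simp
  ring

lemma coefR_succ_eq_weightFun (n : ℕ) :
    coefR ζ (n + 1) = weightFun 1 ζ (orthPoly 0 ζ (n + 2) * orthPoly 1 ζ n) := by
  rw [weightFun_one_mul, (isOrthonormal_orthPoly hζ 0).map_mul_eq_coeff_div
    (natDegree_X_sq_sub_one_mul_orthPoly hζ n).le, coeff_X_sq_sub_one_mul_orthPoly hζ, coefR,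
    Nat.add_sub_cancel, lc, lc]

lemma crossMat_apply (N : ℕ) (i : Fin N) (j : Fin (N + 1)) :
    crossMat ζ N i j = weightFun 1 ζ (orthPoly 0 ζ j * orthPoly 1 ζ i) := by
  have h0 := isOrthonormal_orthPoly hζ 0
  simp only [crossMat]
  split_ifs with hp hq hr
  · rw [hp, coefP_eq_weightFun hζ]
  · rw [hq, coefQ_eq_weightFun hζ]
  · rw [hr, coefR_succ_eq_weightFun hζ]
  · rcases lt_or_gt_of_ne hp with hlt | hgt
    · rw [(isOrthonormal_orthPoly hζ 1).map_mul_eq_zero (by rw [h0.degree_eq]; exact_mod_cast hlt)]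
    · rw [weightFun_one_mul, h0.map_mul_eq_zero]
      refine degree_le_natDegree.trans_lt ?_
      rw [natDegree_X_sq_sub_one_mul_orthPoly hζ]
      exact_mod_cast (by omega : (i : ℕ) + 2 < j)

lemma matA0_apply {M : ℕ} (b b' : Blk M) :
    matA0 M ζ b b' = shellFun ζ (⟨X, 0⟩ * shellBasis M ζ b * shellBasis M ζ b') := by
  rw [shellFun_mul]
  rcases b with i | i <;> rcases b' with j | j <;>
    simp [matA0, shellBasis_inl, shellBasis_inr, jacobiMat_apply hζ]

lemma matA1_apply {M : ℕ} (b b' : Blk M) :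
    matA1 M ζ b b' = shellFun ζ (⟨0, 1⟩ * shellBasis M ζ b * shellBasis M ζ b') := by
  rw [shellFun_mul]
  rcases b with i | i <;> rcases b' with j | j <;>
    simp [matA1, shellBasis_inl, shellBasis_inr, crossMat_apply hζ, weightFun_one_mul]

end

/-! ### The generalized eigenvalue problem -/

lemma degree_mul_lt_of_le_of_lt {f g : ℝ[X]} {m n : ℕ} (hf : f.degree ≤ m) (hg : g.degree < n) :
    (f * g).degree < (n + m : ℕ) := by
  rcases eq_or_ne g 0 with rfl | hg0
  · rw [mul_zero, degree_zero]
    exact WithBot.bot_lt_coe _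
  · rw [degree_eq_natDegree hg0, Nat.cast_lt] at hg
    refine degree_le_natDegree.trans_lt (Nat.cast_lt.2 (natDegree_mul_le.trans_lt ?_))
    have := natDegree_le_iff_degree_le.2 hf
    omega

lemma X_mul_mem_shellSpace {M : ℕ} {v : ShellPoly} (hv : v ∈ shellSpace M) :
    ⟨X, 0⟩ * v ∈ shellSpace (M + 1) := by
  have hX : (X : ℝ[X]).degree ≤ (1 : ℕ) := degree_X_le
  rw [mem_shellSpace]
  simpa using And.intro (degree_mul_lt_of_le_of_lt hX hv.1) (degree_mul_lt_of_le_of_lt hX hv.2)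

lemma omega_mul_mem_shellSpace {M : ℕ} {v : ShellPoly} (hv : v ∈ shellSpace M) :
    ⟨0, 1⟩ * v ∈ shellSpace (M + 1) := by
  have hX : (X ^ 2 - 1 : ℝ[X]).degree ≤ (2 : ℕ) := (degree_X_pow_sub_C two_pos (1 : ℝ)).le
  rw [mem_shellSpace]
  simpa [add_assoc, one_add_one_eq_two] using And.intro (degree_mul_lt_of_le_of_lt hX hv.2) hv.1

section

variable {ζ : ℝ} (hζ : 0 < ζ) {M : ℕ}

include hζ

lemma sum_shellFun_mul_map_shellBasis {L : ShellPoly →ₗ[ℝ] ℝ}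
    (hL0 : L ⟨orthPoly 0 ζ (M + 1), 0⟩ = 0) (hL1 : L ⟨0, orthPoly 1 ζ M⟩ = 0) {v : ShellPoly}
    (hv : v ∈ shellSpace (M + 1)) :
    ∑ b : Blk M, shellFun ζ (v * shellBasis M ζ b) * L (shellBasis M ζ b) = L v := by
  rw [map_eq_sum_shellBasis hζ L hv, Fintype.sum_sum_type, Fintype.sum_sum_type]
  congr 1
  · conv_rhs => rw [Fin.sum_univ_castSucc]
    simp [shellBasis_inl, hL0]
  · conv_rhs => rw [Fin.sum_univ_castSucc]
    simp [shellBasis_inr, hL1]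

lemma matA1_mulVec_of_map_mul {L : ShellPoly →ₗ[ℝ] ℝ} {μ : ℝ}
    (hL : ∀ v, L (⟨0, 1⟩ * v) = μ * L (⟨X, 0⟩ * v))
    (hL0 : L ⟨orthPoly 0 ζ (M + 1), 0⟩ = 0) (hL1 : L ⟨0, orthPoly 1 ζ M⟩ = 0) :
    (matA1 M ζ).mulVec (fun b => L (shellBasis M ζ b)) =
      μ • (matA0 M ζ).mulVec (fun b => L (shellBasis M ζ b)) := by
  ext b
  have hb := shellBasis_mem_shellSpace hζ b
  simp only [Matrix.mulVec, dotProduct, Pi.smul_apply, smul_eq_mul, matA0_apply hζ, matA1_apply hζ]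
  rw [sum_shellFun_mul_map_shellBasis hζ hL0 hL1 (X_mul_mem_shellSpace hb),
    sum_shellFun_mul_map_shellBasis hζ hL0 hL1 (omega_mul_mem_shellSpace hb), hL]

end

/-- The functional that combines the values at the two opposite points `±(x, n)`. -/
def pairEval (x n α β : ℝ) : ShellPoly →ₗ[ℝ] ℝ := α • shellEval x n + β • shellEval (-x) (-n)

lemma pairEval_apply (x n α β : ℝ) (v : ShellPoly) :
    pairEval x n α β v = α * shellEval x n v + β * shellEval (-x) (-n) v := rfl

lemma pairEval_omega_mul {x n : ℝ} (h : n ^ 2 = x ^ 2 - 1) (hx : x ≠ 0) (α β : ℝ) (v : ShellPoly) :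
    pairEval x n α β (⟨0, 1⟩ * v) = n / x * pairEval x n α β (⟨X, 0⟩ * v) := by
  have hneg : (-n) ^ 2 = (-x) ^ 2 - 1 := by rw [neg_sq, neg_sq, h]
  simp only [pairEval_apply, shellEval_mul h, shellEval_mul hneg]
  simp only [shellEval_apply, eval_X, eval_one, eval_zero]
  field_simp
  ring

/-- The functional whose values on `shellBasis M ζ` are the entries of `genVec M ζ z i`. -/
def eigenFun (M : ℕ) (ζ : ℝ) (z : ℤ → ℝ) (i : ℤ) : ShellPoly →ₗ[ℝ] ℝ :=
  if i = 0 then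
    pairEval 1 0 ((orthPoly 0 ζ (M + 1)).eval (-1)) (-(orthPoly 0 ζ (M + 1)).eval 1)
  else
    pairEval (z i) (√(z i ^ 2 - 1)) ((orthPoly 1 ζ M).eval (-z i)) ((orthPoly 1 ζ M).eval (z i))

lemma genVec_eq_eigenFun (M : ℕ) (ζ : ℝ) (z : ℤ → ℝ) (i : ℤ) :
    genVec M ζ z i = fun b => eigenFun M ζ z i (shellBasis M ζ b) := by
  ext b
  rw [genVec, eigenFun]
  split_ifs <;> rcases b with k | k <;>
    simp [pairEval_apply, shellEval_apply, shellBasis_inl, shellBasis_inr] <;> ring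

namespace IsZeroList

variable {M : ℕ} {ζ : ℝ} {z : ℤ → ℝ}

lemma one_lt_abs (h : IsZeroList M ζ z) {i : ℤ} (hi : i ∈ Set.Icc (-(M : ℤ)) M) (h0 : i ≠ 0) :
    1 < |z i| := by
  rcases lt_or_gt_of_ne h0 with hneg | hpos
  · rw [← abs_neg, ← h.odd]
    exact (h.one_lt _ ⟨by omega, neg_le.1 hi.1⟩).trans_le (le_abs_self _)
  · exact (h.one_lt _ ⟨by omega, hi.2⟩).trans_le (le_abs_self _)

lemma matA1_mulVec_genVec (h : IsZeroList M ζ z) (hζ : 0 < ζ) {i : ℤ}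
    (hi : i ∈ Set.Icc (-(M : ℤ)) M) :
    (matA1 M ζ).mulVec (genVec M ζ z i) = lamHat z i • (matA0 M ζ).mulVec (genVec M ζ z i) := by
  rw [genVec_eq_eigenFun]
  by_cases h0 : i = 0
  · refine matA1_mulVec_of_map_mul hζ (fun v => ?_) ?_ ?_ <;> simp only [eigenFun, h0, if_true]
    · simpa [lamHat] using
        pairEval_omega_mul (by norm_num : (0 : ℝ) ^ 2 = 1 ^ 2 - 1) one_ne_zero _ _ v
    · simp [pairEval_apply, shellEval_apply]; ring
    · simp [pairEval_apply, shellEval_apply]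
  · have hz := h.one_lt_abs hi h0
    have hroot : polyQ M ζ (z i) = 0 := (h.zeros _).2 ⟨i, hi, h0, rfl⟩
    have hsq : √(z i ^ 2 - 1) ^ 2 = z i ^ 2 - 1 :=
      Real.sq_sqrt (sub_nonneg.2 ((one_lt_sq_iff_one_lt_abs _).2 hz).le)
    refine matA1_mulVec_of_map_mul hζ (fun v => ?_) ?_ ?_ <;> simp only [eigenFun, h0, if_false]
    · rw [lamHat, if_neg h0]
      exact pairEval_omega_mul hsq (abs_pos.1 (one_pos.trans hz)) _ _ v
    · simp only [pairEval_apply, shellEval_apply, eval_zero, mul_zero, add_zero]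
      rw [← hroot, polyQ]
      ring
    · simp only [pairEval_apply, shellEval_apply, eval_zero, zero_add]
      ring

end IsZeroList

section

variable {ζ : ℝ} (hζ : 0 < ζ)

include hζ

lemma abs_eval_orthPoly_ne_abs_eval_neg (ℓ : Fin 2) {n : ℕ} (hn : 0 < n) {x : ℝ} (hx : x ≠ 0) :
    |(orthPoly ℓ ζ n).eval x| ≠ |(orthPoly ℓ ζ n).eval (-x)| := by
  have hP := isOrthonormal_orthPoly hζ ℓ
  have hlt : ∀ y, 0 < y → |(orthPoly ℓ ζ n).eval y| < |(orthPoly ℓ ζ n).eval (-y)| := fun y hy =>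
    abs_eval_lt_abs_eval_neg (hP.splits (isPositiveOn_weightFun hζ ℓ) n) (by rwa [hP.natDegree_eq])
      (fun _ ha => one_pos.trans (orthPoly_roots_pos hζ ℓ n ha)) hy
  rcases lt_or_gt_of_ne hx with hneg | hpos
  · simpa using (hlt (-x) (neg_pos.2 hneg)).ne'
  · exact (hlt x hpos).ne

lemma genVec_ne_zero {M : ℕ} (hM : 1 ≤ M) {z : ℤ → ℝ} {i : ℤ} (hz : i ≠ 0 → z i ≠ 0) :
    genVec M ζ z i ≠ 0 := by
  intro hvec
  have hone : eigenFun M ζ z i ⟨1, 0⟩ = 0 := by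
    rw [map_eq_sum_shellBasis hζ _ (v := ⟨1, 0⟩) (M := M)
      ⟨degree_one_le.trans_lt (by exact_mod_cast M.succ_pos), by simp⟩]
    rw [genVec_eq_eigenFun] at hvec
    exact Finset.sum_eq_zero fun b _ => by rw [congrFun hvec b, Pi.zero_apply, mul_zero]
  rw [eigenFun] at hone
  split_ifs at hone with h0 <;> simp only [pairEval_apply, shellEval_apply, eval_one, eval_zero,
    mul_zero, add_zero, mul_one] at hone
  · refine abs_eval_orthPoly_ne_abs_eval_neg hζ 0 M.succ_pos one_ne_zero ?_
    rw [add_neg_eq_zero.1 hone]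
  · refine abs_eval_orthPoly_ne_abs_eval_neg hζ 1 hM (hz h0) ?_
    rw [eq_neg_of_add_eq_zero_left hone, abs_neg]

end

/-! ### Positive definiteness -/

lemma two_mul_eval_re (v : ShellPoly) (x n : ℝ) :
    2 * v.re.eval x = shellEval x n v + shellEval x (-n) v := by
  simp only [shellEval_apply]
  ring

lemma two_mul_eval_re_mul_sq {u x n : ℝ} (h : n ^ 2 = x ^ 2 - 1) (v : ShellPoly) :
    2 * ((⟨X, -C u⟩ : ShellPoly) * (v * v)).re.eval x =
      (x - u * n) * shellEval x n v ^ 2 + (x + u * n) * shellEval x (-n) v ^ 2 := by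
  have hneg : (-n) ^ 2 = x ^ 2 - 1 := by rw [neg_sq, h]
  simp only [two_mul_eval_re _ x n, shellEval_mul h, shellEval_mul hneg]
  simp only [shellEval_apply, eval_X, eval_neg, eval_C]
  ring

lemma abs_mul_sqrt_sq_sub_one_lt {u x : ℝ} (hu : |u| < 1) (hx : 1 ≤ x) :
    |u * √(x ^ 2 - 1)| < x := by
  have hsqrt : √(x ^ 2 - 1) < x := (Real.sqrt_lt' (by linarith)).2 (by linarith)
  rw [abs_mul, abs_of_nonneg (Real.sqrt_nonneg _)]
  exact (mul_le_of_le_one_left (Real.sqrt_nonneg _) hu.le).trans_lt hsqrt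

lemma eq_zero_of_shellEval_eq_zero {v : ShellPoly}
    (h : ∀ x : ℝ, 1 < x → shellEval x (√(x ^ 2 - 1)) v = 0 ∧ shellEval x (-√(x ^ 2 - 1)) v = 0) :
    v = 0 := by
  have hzero : ∀ x : ℝ, 1 < x → v.re.eval x = 0 ∧ v.im.eval x = 0 := fun x hx => by
    obtain ⟨hpos, hneg⟩ := h x hx
    rw [shellEval_apply] at hpos hneg
    have hsqrt : 0 < √(x ^ 2 - 1) := Real.sqrt_pos.2 (by nlinarith)
    refine ⟨by linarith, ?_⟩
    have : √(x ^ 2 - 1) * v.im.eval x = 0 := by linarith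
    exact (mul_eq_zero.1 this).resolve_left hsqrt.ne'
  ext1
  · exact eq_zero_of_infinite_isRoot _ ((Set.Ioi_infinite 1).mono fun x hx => (hzero x hx).1)
  · exact eq_zero_of_infinite_isRoot _ ((Set.Ioi_infinite 1).mono fun x hx => (hzero x hx).2)

section

variable {ζ : ℝ} (hζ : 0 < ζ) {u : ℝ} (hu : |u| < 1)

include hζ hu

lemma shellFun_mul_sq_pos {v : ShellPoly} (hv : v ≠ 0) : 0 < shellFun ζ (⟨X, -C u⟩ * (v * v)) := by
  have hcoef : ∀ x : ℝ, 1 ≤ x → 0 < x - u * √(x ^ 2 - 1) ∧ 0 < x + u * √(x ^ 2 - 1) := fun x hx =>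
    have h := abs_lt.1 (abs_mul_sqrt_sq_sub_one_lt hu hx)
    ⟨by linarith, by linarith⟩
  have hsq : ∀ x : ℝ, 1 ≤ x → √(x ^ 2 - 1) ^ 2 = x ^ 2 - 1 := fun x hx =>
    Real.sq_sqrt (by nlinarith)
  refine isPositiveOn_weightFun hζ 0 _ (fun hre => hv (eq_zero_of_shellEval_eq_zero fun x hx => ?_))
    fun x hx => ?_
  · have hid := two_mul_eval_re_mul_sq (u := u) (hsq x hx.le) v
    obtain ⟨hminus, hplus⟩ := hcoef x hx.le
    rw [hre, eval_zero, mul_zero] at hid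
    have hnonneg₁ := mul_nonneg hminus.le (sq_nonneg (shellEval x (√(x ^ 2 - 1)) v))
    have hnonneg₂ := mul_nonneg hplus.le (sq_nonneg (shellEval x (-√(x ^ 2 - 1)) v))
    exact ⟨by simpa [hminus.ne'] using (by linarith :
        (x - u * √(x ^ 2 - 1)) * shellEval x (√(x ^ 2 - 1)) v ^ 2 = 0),
      by simpa [hplus.ne'] using (by linarith :
        (x + u * √(x ^ 2 - 1)) * shellEval x (-√(x ^ 2 - 1)) v ^ 2 = 0)⟩
  · have hid := two_mul_eval_re_mul_sq (u := u) (hsq x hx) v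
    obtain ⟨hminus, hplus⟩ := hcoef x hx
    have : 0 ≤ 2 * ((⟨X, -C u⟩ : ShellPoly) * (v * v)).re.eval x := by rw [hid]; positivity
    linarith

lemma posDef_matA0_sub_smul_matA1 (M : ℕ) : (matA0 M ζ - u • matA1 M ζ).PosDef := by
  have happly : ∀ b b', (matA0 M ζ - u • matA1 M ζ) b b' =
      shellFun ζ (⟨X, -C u⟩ * (shellBasis M ζ b * shellBasis M ζ b')) := fun b b' => by
    have hsplit : (⟨X, -C u⟩ : ShellPoly) = ⟨X, 0⟩ - u • ⟨0, 1⟩ := by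
      ext1 <;> simp [smul_eq_C_mul]
    rw [hsplit, sub_mul, map_sub, smul_mul_assoc, map_smul, ← mul_assoc, ← mul_assoc,
      ← matA0_apply hζ, ← matA1_apply hζ]
    rfl
  refine Matrix.PosDef.of_dotProduct_mulVec_pos
    (Matrix.IsHermitian.ext fun b b' => by
      rw [star_trivial, happly, happly, mul_comm (shellBasis _ _ _)])
    fun {y} hy => ?_
  set v := ∑ b, y b • shellBasis M ζ b with hv
  have hquad : star y ⬝ᵥ (matA0 M ζ - u • matA1 M ζ).mulVec y =
      shellFun ζ (⟨X, -C u⟩ * (v * v)) := by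
    simp only [dotProduct, Matrix.mulVec, happly, star_trivial, hv, Finset.mul_sum, Finset.sum_mul,
      map_sum, smul_mul_assoc, mul_smul_comm, map_smul, smul_eq_mul, Pi.star_apply]
    exact Finset.sum_comm.trans (Finset.sum_congr rfl fun b _ => Finset.sum_congr rfl fun b' _ => by
      ring)
  rw [hquad]
  refine shellFun_mul_sq_pos hζ hu fun hv0 => hy (funext fun b => ?_)
  rw [← shellFun_sum_smul_mul_shellBasis hζ y b, ← hv, hv0, zero_mul, map_zero, Pi.zero_apply]

end

/-! ### Eigenvalues of the pair -/

lemma isEigenSystem_of_eigen {ι : Type} [Fintype ι] [DecidableEq ι] {M : ℕ}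
    {A0 A1 : Matrix ι ι ℝ} {μ : ℤ → ℝ} {y : ℤ → ι → ℝ} (hcard : Fintype.card ι = 2 * M + 1)
    (hdet : IsUnit A0.det) (hinj : Set.InjOn μ (Set.Icc (-(M : ℤ)) M))
    (hne : ∀ i ∈ Set.Icc (-(M : ℤ)) M, y i ≠ 0)
    (heig : ∀ i ∈ Set.Icc (-(M : ℤ)) M, A1.mulVec (y i) = μ i • A0.mulVec (y i)) :
    IsEigenSystem M A0 A1 μ y := by
  refine ⟨hdet, hinj, ?_, hne, heig⟩
  have hroot : ∀ i ∈ Finset.Icc (-(M : ℤ)) M, X - C (μ i) ∣ (A0⁻¹ * A1).charpoly := by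
    intro i hi
    have hi' : i ∈ Set.Icc (-(M : ℤ)) M := Finset.mem_Icc.1 hi
    rw [dvd_iff_isRoot, IsRoot.def, Matrix.eval_charpoly]
    refine Matrix.exists_mulVec_eq_zero_iff.1 ⟨y i, hne i hi', ?_⟩
    rw [Matrix.sub_mulVec, ← Matrix.mulVec_mulVec, heig i hi', Matrix.mulVec_smul,
      Matrix.mulVec_mulVec, Matrix.nonsing_inv_mul _ hdet, Matrix.one_mulVec]
    ext j
    simp [Matrix.scalar_apply]
  have hdvd : ∏ i ∈ Finset.Icc (-(M : ℤ)) M, (X - C (μ i)) ∣ (A0⁻¹ * A1).charpoly := by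
    refine Finset.prod_dvd_of_coprime (fun i hi j hj hij => ?_) hroot
    refine isCoprime_X_sub_C_of_isUnit_sub ?_
    rw [isUnit_iff_ne_zero, sub_ne_zero]
    exact fun h => hij (hinj (Finset.mem_Icc.1 hi) (Finset.mem_Icc.1 hj) h)
  refine eq_of_monic_of_dvd_of_natDegree_le (monic_prod_of_monic _ _ fun i _ => monic_X_sub_C _)
    (Matrix.charpoly_monic _) hdvd (le_of_eq ?_)
  rw [Matrix.charpoly_natDegree_eq_dim, hcard,
    natDegree_prod_of_monic _ _ fun i _ => monic_X_sub_C _]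
  simp only [natDegree_X_sub_C, Finset.sum_const, Int.card_Icc, smul_eq_mul, mul_one]
  omega

@[simp]
lemma lamHat_zero (z : ℤ → ℝ) : lamHat z 0 = 0 := if_pos rfl

namespace IsZeroList

variable {M : ℕ} {ζ : ℝ} {z : ℤ → ℝ}

lemma lamHat_neg (h : IsZeroList M ζ z) (i : ℤ) : lamHat z (-i) = -lamHat z i := by
  simp only [lamHat, neg_eq_zero, h.odd, neg_sq, div_neg]
  split_ifs <;> simp only [neg_zero]

lemma lamHat_pos (h : IsZeroList M ζ z) {i : ℤ} (hi : i ∈ Set.Icc (1 : ℤ) M) :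
    0 < lamHat z i := by
  have hz := h.one_lt i hi
  rw [lamHat, if_neg (one_pos.trans_le hi.1).ne']
  exact div_pos (Real.sqrt_pos.2 (by nlinarith)) (one_pos.trans hz)

lemma lamHat_sq (h : IsZeroList M ζ z) {i : ℤ} (hi : i ∈ Set.Icc (-(M : ℤ)) M) (h0 : i ≠ 0) :
    lamHat z i ^ 2 = 1 - (z i ^ 2)⁻¹ := by
  have hsq : 1 < z i ^ 2 := (one_lt_sq_iff_one_lt_abs _).2 (h.one_lt_abs hi h0)
  rw [lamHat, if_neg h0, div_pow, Real.sq_sqrt (by linarith), sub_div, one_div,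
    div_self (by linarith)]

lemma abs_lamHat_lt_one (h : IsZeroList M ζ z) {i : ℤ} (hi : i ∈ Set.Icc (-(M : ℤ)) M) :
    |lamHat z i| < 1 := by
  rcases eq_or_ne i 0 with rfl | h0
  · simp
  · have hsq : 1 < z i ^ 2 := (one_lt_sq_iff_one_lt_abs _).2 (h.one_lt_abs hi h0)
    rw [← sq_lt_one_iff_abs_lt_one, h.lamHat_sq hi h0]
    have : 0 < (z i ^ 2)⁻¹ := by positivity
    linarith

lemma lamHat_lt_lamHat (h : IsZeroList M ζ z) {i j : ℤ} (hi : 0 ≤ i) (hij : i < j)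
    (hj : j ≤ M) : lamHat z i < lamHat z j := by
  have hj' : j ∈ Set.Icc (1 : ℤ) M := ⟨by omega, hj⟩
  rcases hi.eq_or_lt with rfl | hi
  · simpa using h.lamHat_pos hj'
  · have hi' : i ∈ Set.Icc (1 : ℤ) M := ⟨hi, by omega⟩
    have hz := h.one_lt i hi'
    have hzlt := h.strictMonoOn hi' hj' hij
    refine lt_of_pow_lt_pow_left₀ 2 (h.lamHat_pos hj').le ?_
    rw [h.lamHat_sq ⟨by omega, hi'.2⟩ hi.ne', h.lamHat_sq ⟨by omega, hj⟩ (by omega)]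
    gcongr

lemma strictMonoOn_lamHat (h : IsZeroList M ζ z) :
    StrictMonoOn (lamHat z) (Set.Icc (-(M : ℤ)) M) := by
  rintro i ⟨hi, _⟩ j ⟨_, hj'⟩ hij
  rcases le_or_gt 0 i with hi0 | hi0
  · exact h.lamHat_lt_lamHat hi0 hij hj'
  rcases le_or_gt j 0 with hj0 | hj0
  · have := h.lamHat_lt_lamHat (neg_nonneg.2 hj0) (neg_lt_neg hij) (by omega)
    rwa [h.lamHat_neg, h.lamHat_neg, neg_lt_neg_iff] at this
  · have hneg := h.lamHat_pos (i := -i) ⟨by omega, by omega⟩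
    have hpos := h.lamHat_pos (i := j) ⟨by omega, hj'⟩
    rw [h.lamHat_neg] at hneg
    linarith

theorem isEigenSystem_pair (h : IsZeroList M ζ z) (hζ : 0 < ζ) (hM : 1 ≤ M) :
    IsEigenSystem M (matA0 M ζ) (matA1 M ζ) (lamHat z) (genVec M ζ z) := by
  have hposDef := posDef_matA0_sub_smul_matA1 hζ (u := 0) (by simp) M
  rw [zero_smul, sub_zero] at hposDef
  exact isEigenSystem_of_eigen (by simp; omega) hposDef.det_pos.ne'.isUnit
    h.strictMonoOn_lamHat.injOn
    (fun i hi => genVec_ne_zero hζ hM fun h0 => abs_pos.1 (one_pos.trans (h.one_lt_abs hi h0)))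
    fun i hi => h.matA1_mulVec_genVec hζ hi

end IsZeroList

/-! ### Kinematics -/

/-- The normalized momentum `(U⁰)⁻¹ p_{<1>}`. -/
def nmom (u p : ℝ) : ℝ := (U0 u)⁻¹ * pLow u p

lemma U1_eq (u : ℝ) : U1 u = u * U0 u := by rw [U1, U0, mul_one_div]

section

variable {u : ℝ} (hu : |u| < 1)

include hu

lemma one_sub_sq_pos : 0 < 1 - u ^ 2 := sub_pos.2 ((sq_lt_one_iff_abs_lt_one u).2 hu)

lemma U0_pos : 0 < U0 u := one_div_pos.2 (Real.sqrt_pos.2 (one_sub_sq_pos hu))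

lemma U0_sq_mul : U0 u ^ 2 * (1 - u ^ 2) = 1 := by
  have h := one_sub_sq_pos hu
  rw [U0, div_pow, Real.sq_sqrt h.le, one_pow, one_div, inv_mul_cancel₀ h.ne']

lemma U0_sq_eq : U0 u ^ 2 = 1 + U1 u ^ 2 := by
  rw [U1_eq]
  linear_combination U0_sq_mul hu

lemma nmom_eq (p : ℝ) : nmom u p = U1 u * p0 p - U0 u * p := by
  rw [nmom, pLow, energy, inv_mul_eq_iff_eq_mul₀ (U0_pos hu).ne']
  linear_combination p * U0_sq_eq hu

lemma nmom_sq (p : ℝ) : nmom u p ^ 2 = energy u p ^ 2 - 1 := by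
  have hp : p0 p ^ 2 = 1 + p ^ 2 := Real.sq_sqrt (by positivity)
  rw [nmom_eq hu, energy]
  linear_combination -hp - (p0 p ^ 2 - p ^ 2) * U0_sq_eq hu

lemma exists_rapidity : ∃ φ : ℝ, U0 u = Real.cosh φ ∧ U1 u = Real.sinh φ := by
  refine ⟨Real.arsinh (U1 u), ?_, (Real.sinh_arsinh _).symm⟩
  rw [Real.cosh_arsinh, ← U0_sq_eq hu, Real.sqrt_sq (U0_pos hu).le]

omit hu in
lemma p0_sinh (t : ℝ) : p0 (Real.sinh t) = Real.cosh t := by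
  rw [p0, add_comm, ← Real.cosh_sq, Real.sqrt_sq (Real.cosh_pos t).le]

lemma hasDerivAt_U0 : HasDerivAt U0 (u * U0 u ^ 3) u := by
  have hpos := one_sub_sq_pos hu
  have hsqrt := Real.sqrt_pos.2 hpos
  have hbase : HasDerivAt (fun x : ℝ => 1 - x ^ 2) (-(2 * u)) u := by
    simpa using (hasDerivAt_pow 2 u).const_sub 1
  rw [show U0 = (fun x : ℝ => Real.sqrt (1 - x ^ 2))⁻¹ from funext fun x => one_div _]
  refine ((hbase.sqrt hpos.ne').inv hsqrt.ne').congr_deriv ?_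
  rw [Pi.inv_apply]
  field_simp

lemma hasDerivAt_U1 : HasDerivAt U1 (U0 u ^ 3) u := by
  rw [show U1 = id * U0 from funext U1_eq]
  refine ((hasDerivAt_id u).mul (hasDerivAt_U0 hu)).congr_deriv ?_
  rw [id]
  linear_combination -U0 u * U0_sq_mul hu

lemma hasDerivAt_energy (p : ℝ) :
    HasDerivAt (fun s => energy s p) (U0 u ^ 2 * nmom u p) u := by
  refine (((hasDerivAt_U0 hu).mul_const (p0 p)).sub
    ((hasDerivAt_U1 hu).mul_const p)).congr_deriv ?_
  rw [nmom_eq hu, U1_eq]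
  ring

lemma hasDerivAt_nmom (p : ℝ) :
    HasDerivAt (fun s => nmom s p) (U0 u ^ 2 * energy u p) u := by
  have hev : (fun s => nmom s p) =ᶠ[nhds u] fun s => U1 s * p0 p - U0 s * p :=
    (continuous_abs.continuousAt.eventually_lt_const hu).mono fun s hs => nmom_eq hs p
  refine ((((hasDerivAt_U1 hu).mul_const (p0 p)).sub
    ((hasDerivAt_U0 hu).mul_const p)).congr_of_eventuallyEq hev).congr_deriv ?_
  rw [energy, U1_eq]
  ring

lemma integral_energy_nmom_div_p0 (H : ℝ → ℝ → ℝ) :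
    ∫ p : ℝ, H (energy u p) (nmom u p) / p0 p = ∫ t : ℝ, H (Real.cosh t) (-Real.sinh t) := by
  obtain ⟨φ, h0, h1⟩ := exists_rapidity hu
  rw [← setIntegral_univ, ← Real.sinh_surjective.range_eq, ← Set.image_univ,
    integral_image_eq_integral_abs_deriv_smul MeasurableSet.univ
      (fun t _ => (Real.hasDerivAt_sinh t).hasDerivWithinAt) Real.sinh_injective.injOn,
    setIntegral_univ, ← integral_sub_right_eq_self (fun t => H (Real.cosh t) (-Real.sinh t)) φ]
  refine integral_congr_ae (Filter.Eventually.of_forall fun t => ?_)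
  have henergy : energy u (Real.sinh t) = Real.cosh (t - φ) := by
    rw [energy, p0_sinh, h0, h1, Real.cosh_sub]
    ring
  have hnmom : nmom u (Real.sinh t) = -Real.sinh (t - φ) := by
    rw [nmom_eq hu, p0_sinh, h0, h1, Real.sinh_sub]
    ring
  have hcosh := Real.cosh_pos t
  simp only [henergy, hnmom, p0_sinh, abs_of_pos hcosh, smul_eq_mul]
  field_simp

end

/-! ### Distributions on the mass shell -/

/-- The distribution `g v(E, (U⁰)⁻¹ p_{<1>})` of the momentum. -/
def shellDist (u θ : ℝ) (v : ShellPoly) (p : ℝ) : ℝ :=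
  gEq u θ p * shellEval (energy u p) (nmom u p) v

lemma integral_sinh_mul_eval_cosh_mul_exp (ζ : ℝ) (f : ℝ[X]) :
    ∫ t : ℝ, Real.sinh t * f.eval (Real.cosh t) * Real.exp (-ζ * Real.cosh t) = 0 := by
  have h := integral_neg_eq_self
    (fun t : ℝ => Real.sinh t * f.eval (Real.cosh t) * Real.exp (-ζ * Real.cosh t)) volume
  simp only [Real.sinh_neg, Real.cosh_neg, neg_mul, integral_neg] at h ⊢
  linarith

section

variable {θ : ℝ} (hθ : 0 < θ)

include hθ

lemma gEq_eq (u p : ℝ) :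
    gEq u θ p = (expMom θ⁻¹ X)⁻¹ * Real.exp (-θ⁻¹ * energy u p) := by
  rw [gEq, ← expMom_X_eq_two_mul_besselK (inv_pos.2 hθ), one_div, div_eq_inv_mul, neg_mul]

lemma gEq_pos (u p : ℝ) : 0 < gEq u θ p := by
  rw [gEq_eq hθ]
  exact mul_pos (inv_pos.2 (expMom_X_pos (inv_pos.2 hθ))) (Real.exp_pos _)

lemma integral_shellDist_div_p0 {u : ℝ} (hu : |u| < 1) (v : ShellPoly) :
    ∫ p, shellDist u θ v p / p0 p = shellFun θ⁻¹ v := by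
  have hζ := inv_pos.2 hθ
  simp only [shellDist, gEq_eq hθ]
  rw [integral_energy_nmom_div_p0 hu fun x n =>
    (expMom θ⁻¹ X)⁻¹ * Real.exp (-θ⁻¹ * x) * shellEval x n v]
  have hsplit : ∀ t : ℝ, (expMom θ⁻¹ X)⁻¹ * Real.exp (-θ⁻¹ * Real.cosh t) *
      shellEval (Real.cosh t) (-Real.sinh t) v =
      (expMom θ⁻¹ X)⁻¹ * (v.re.eval (Real.cosh t) * Real.exp (-θ⁻¹ * Real.cosh t) -
        Real.sinh t * v.im.eval (Real.cosh t) * Real.exp (-θ⁻¹ * Real.cosh t)) := fun t => by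
    rw [shellEval_apply]
    ring
  simp only [hsplit]
  rw [integral_const_mul, integral_sub (integrable_eval_cosh_mul_exp hζ _)
    (integrable_sinh_mul_eval_cosh_mul_exp hζ _), integral_sinh_mul_eval_cosh_mul_exp, sub_zero,
    ← expMom_eq_integral hζ, shellFun_apply, weightFun_zero_apply]

lemma gip_shellDist {u : ℝ} (hu : |u| < 1) (v w : ShellPoly) :
    gip u θ (shellDist u θ v) (shellDist u θ w) = shellFun θ⁻¹ (v * w) := by
  rw [← integral_shellDist_div_p0 hθ hu]
  refine integral_congr_ae (Filter.Eventually.of_forall fun p => ?_)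
  have hg := (gEq_pos hθ u p).ne'
  simp only [shellDist, shellEval_mul (nmom_sq hu p)]
  field_simp

end

/-! ### The velocity derivative -/

/-- The derivation of `ShellPoly` with `x ↦ n` and `n ↦ x`, i.e. the derivative with respect to the
rapidity. -/
def boost (v : ShellPoly) : ShellPoly :=
  ⟨X * v.im + (X ^ 2 - 1) * derivative v.im, derivative v.re⟩

lemma boost_mul (v w : ShellPoly) : boost (v * w) = boost v * w + v * boost w := by
  ext1
  · simp only [boost, QuadraticAlgebra.re_add, QuadraticAlgebra.re_mul, QuadraticAlgebra.im_mul,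
      derivative_add, derivative_mul, zero_mul, add_zero]
    ring
  · simp only [boost, QuadraticAlgebra.im_add, QuadraticAlgebra.re_mul, QuadraticAlgebra.im_mul,
      derivative_add, derivative_sub, derivative_mul, derivative_X_sq, derivative_one, zero_mul,
      add_zero, map_ofNat]
    ring

lemma shellFun_boost {ζ : ℝ} (hζ : 0 < ζ) (v : ShellPoly) :
    shellFun ζ (boost v) = shellFun ζ (⟨0, C ζ⟩ * v) := by
  have h := expMom_by_parts hζ v.im
  rw [← sub_eq_zero, ← map_sub, shellFun_apply, weightFun_zero_apply]
  refine mul_eq_zero_of_right _ (Eq.trans (congrArg _ ?_) h)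
  simp only [boost, QuadraticAlgebra.re_sub, QuadraticAlgebra.re_mul]
  ring

/-- The velocity derivative of `shellDist`, up to the factor `(U⁰)²`; the second term comes from
the exponential in `g`. -/
def velDeriv (ζ : ℝ) (v : ShellPoly) : ShellPoly := boost v - ⟨0, C ζ⟩ * v

lemma shellFun_velDeriv_mul {ζ : ℝ} (hζ : 0 < ζ) (v w : ShellPoly) :
    shellFun ζ (velDeriv ζ v * w) = -shellFun ζ (v * boost w) := by
  rw [velDeriv, sub_mul, mul_assoc, map_sub, ← shellFun_boost hζ, boost_mul, map_add]
  ring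

lemma hasDerivAt_shellEval_boost {u : ℝ} (hu : |u| < 1) (v : ShellPoly) (p : ℝ) :
    HasDerivAt (fun s => shellEval (energy s p) (nmom s p) v)
      (U0 u ^ 2 * shellEval (energy u p) (nmom u p) (boost v)) u := by
  have hE := hasDerivAt_energy hu p
  have hre := (v.re.hasDerivAt (energy u p)).comp u hE
  have him := (v.im.hasDerivAt (energy u p)).comp u hE
  refine (hre.add ((hasDerivAt_nmom hu p).mul him)).congr_deriv ?_
  simp only [shellEval_apply, boost, eval_add, eval_mul, eval_sub, eval_pow, eval_X, eval_one,
    Function.comp_apply, ← nmom_sq hu]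
  ring

lemma hasDerivAt_shellDist_vel {u θ : ℝ} (hu : |u| < 1) (hθ : 0 < θ) (v : ShellPoly) (p : ℝ) :
    HasDerivAt (fun s => shellDist s θ v p)
      (shellDist u θ (U0 u ^ 2 • velDeriv θ⁻¹ v) p) u := by
  have hexp := (((hasDerivAt_energy hu p).const_mul (-θ⁻¹)).exp).const_mul (expMom θ⁻¹ X)⁻¹
  simp only [shellDist, gEq_eq hθ]
  refine (hexp.mul (hasDerivAt_shellEval_boost hu v p)).congr_deriv ?_
  rw [map_smul, smul_eq_mul, velDeriv, map_sub, shellEval_mul (nmom_sq hu p),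
    shellEval_apply _ _ ⟨0, _⟩, eval_zero, eval_C]
  ring

/-! ### Differentiable families -/

/-- The families `t ↦ ∑ i, c i t • e i` with finitely many fixed vectors `e i` and coefficients
`c i` that are differentiable at `s`. -/
def diffFamilies (E : Type*) [AddCommGroup E] [Module ℝ E] (s : ℝ) : Submodule ℝ (ℝ → E) :=
  Submodule.span ℝ {V | ∃ c : ℝ → ℝ, DifferentiableAt ℝ c s ∧ ∃ e : E, V = fun t => c t • e}

section

variable {E F : Type*} [AddCommGroup E] [Module ℝ E] [AddCommGroup F] [Module ℝ F] {s : ℝ}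

lemma smul_const_mem_diffFamilies {c : ℝ → ℝ} (hc : DifferentiableAt ℝ c s) (e : E) :
    (fun t => c t • e) ∈ diffFamilies E s :=
  Submodule.subset_span ⟨c, hc, e, rfl⟩

lemma const_mem_diffFamilies (e : E) : (fun _ => e) ∈ diffFamilies E s := by
  simpa only [one_smul] using smul_const_mem_diffFamilies (differentiableAt_const (1 : ℝ)) e

lemma comp_mem_diffFamilies {φ : ℝ → ℝ} (hφ : DifferentiableAt ℝ φ s) {V : ℝ → E}
    (hV : V ∈ diffFamilies E (φ s)) : (fun t => V (φ t)) ∈ diffFamilies E s := by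
  have hle : diffFamilies E (φ s) ≤ (diffFamilies E s).comap (LinearMap.funLeft ℝ E φ) := by
    refine Submodule.span_le.2 ?_
    rintro _ ⟨c, hc, e, rfl⟩
    exact smul_const_mem_diffFamilies (hc.fun_comp' s hφ) e
  exact hle hV

lemma map_mem_diffFamilies (L : E →ₗ[ℝ] F) {V : ℝ → E} (hV : V ∈ diffFamilies E s) :
    (fun t => L (V t)) ∈ diffFamilies F s := by
  have hle : diffFamilies E s ≤ (diffFamilies F s).comap (L.compLeft ℝ) := by
    refine Submodule.span_le.2 ?_
    rintro _ ⟨c, hc, e, rfl⟩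
    have hmap : L.compLeft ℝ (fun t => c t • e) = fun t => c t • L e :=
      funext fun t => map_smul L (c t) e
    rw [SetLike.mem_coe, Submodule.mem_comap, hmap]
    exact smul_const_mem_diffFamilies hc (L e)
  exact hle hV

lemma smul_mem_diffFamilies {c : ℝ → ℝ} (hc : DifferentiableAt ℝ c s) {V : ℝ → E}
    (hV : V ∈ diffFamilies E s) : (fun t => c t • V t) ∈ diffFamilies E s := by
  let smulLin : (ℝ → E) →ₗ[ℝ] ℝ → E := LinearMap.pi fun t => c t • LinearMap.proj t
  have hle : diffFamilies E s ≤ (diffFamilies E s).comap smulLin := by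
    refine Submodule.span_le.2 ?_
    rintro _ ⟨d, hd, e, rfl⟩
    have hmul : smulLin (fun t => d t • e) = fun t => (c t * d t) • e :=
      funext fun t => smul_smul (c t) (d t) e
    rw [SetLike.mem_coe, Submodule.mem_comap, hmul]
    exact smul_const_mem_diffFamilies (hc.fun_mul hd) e
  exact hle hV

lemma exists_hasDerivAt_map {V : ℝ → E} (hV : V ∈ diffFamilies E s) :
    ∃ V' : E, ∀ L : ℝ → E →ₗ[ℝ] ℝ, (∀ e, DifferentiableAt ℝ (fun t => L t e) s) →
      HasDerivAt (fun t => L t (V t)) (L s V' + deriv (fun t => L t (V s)) s) s := by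
  induction hV using Submodule.span_induction with
  | mem V h =>
    obtain ⟨c, hc, e, rfl⟩ := h
    refine ⟨deriv c s • e, fun L hL => ?_⟩
    simp only [map_smul, smul_eq_mul, deriv_const_mul _ (hL e)]
    exact hc.hasDerivAt.fun_mul (hL e).hasDerivAt
  | zero => exact ⟨0, fun L _ => by simpa using hasDerivAt_const s (0 : ℝ)⟩
  | add V W _ _ hV hW =>
    obtain ⟨V', hV'⟩ := hV
    obtain ⟨W', hW'⟩ := hW
    refine ⟨V' + W', fun L hL => ?_⟩
    simp only [Pi.add_apply, map_add, deriv_fun_add (hL _) (hL _)]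
    exact ((hV' L hL).fun_add (hW' L hL)).congr_deriv (add_add_add_comm _ _ _ _)
  | smul a V _ hV =>
    obtain ⟨V', hV'⟩ := hV
    refine ⟨a • V', fun L hL => ?_⟩
    simp only [Pi.smul_apply, map_smul, smul_eq_mul, deriv_const_mul _ (hL _), ← mul_add]
    exact (hV' L hL).const_mul a

end

section

variable {R : Type*} [Ring R] [Algebra ℝ R] {s : ℝ}

lemma mul_mem_diffFamilies {V W : ℝ → R} (hV : V ∈ diffFamilies R s) (hW : W ∈ diffFamilies R s) :
    V * W ∈ diffFamilies R s := by
  have hVW := Submodule.mul_mem_mul hV hW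
  rw [diffFamilies, Submodule.span_mul_span] at hVW
  refine Submodule.span_mono ?_ hVW
  rintro _ ⟨_, ⟨c, hc, e, rfl⟩, _, ⟨d, hd, f, rfl⟩, rfl⟩
  exact ⟨_, hc.fun_mul hd, e * f, funext fun t => smul_mul_smul_comm _ _ _ _⟩

end

/-! ### Dependence on the temperature -/

section

variable {ζ : ℝ} (hζ : 0 < ζ)

include hζ

lemma hasDerivAt_weightFun_zero (f : ℝ[X]) :
    HasDerivAt (fun s => weightFun 0 s f)
      (-weightFun 0 ζ ((X - C (weightFun 0 ζ (X ^ 2))) * f)) ζ := by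
  have hX := (expMom_X_pos hζ).ne'
  simp only [weightFun_zero_apply]
  refine (((hasDerivAt_expMom hζ X).fun_inv hX).fun_mul (hasDerivAt_expMom hζ f)).congr_deriv ?_
  rw [sub_mul, map_sub, ← smul_eq_C_mul, map_smul, smul_eq_mul, ← pow_two]
  field_simp
  ring

lemma differentiableAt_weightFun (ℓ : Fin 2) (f : ℝ[X]) :
    DifferentiableAt ℝ (fun s => weightFun ℓ s f) ζ := by
  simp only [weightFun_apply ℓ]
  exact (hasDerivAt_weightFun_zero hζ _).differentiableAt

lemma differentiableAt_wip (ℓ : Fin 2) {V W : ℝ → ℝ[X]} (hV : V ∈ diffFamilies ℝ[X] ζ)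
    (hW : W ∈ diffFamilies ℝ[X] ζ) : DifferentiableAt ℝ (fun s => wip ℓ s (V s) (W s)) ζ := by
  obtain ⟨D, hD⟩ := exists_hasDerivAt_map (mul_mem_diffFamilies hV hW)
  refine (hD (weightFun ℓ)
    (differentiableAt_weightFun hζ ℓ)).differentiableAt.congr_of_eventuallyEq ?_
  exact (eventually_gt_nhds hζ).mono fun s hs => wip_eq_weightFun ℓ hs _ _

lemma orthPoly_mem_diffFamilies (ℓ : Fin 2) (n : ℕ) :
    (fun s => orthPoly ℓ s n) ∈ diffFamilies ℝ[X] ζ := by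
  induction n using Nat.strong_induction_on with
  | _ n ih =>
    have hq : (fun s => preOrthPoly ℓ s n) ∈ diffFamilies ℝ[X] ζ := by
      have hsum : (fun s => preOrthPoly ℓ s n) = (fun _ => X ^ n) -
          ∑ k ∈ Finset.range n, fun s => wip ℓ s (X ^ n) (orthPoly ℓ s k) • orthPoly ℓ s k := by
        ext1 s
        simp only [preOrthPoly, smul_eq_C_mul, Pi.sub_apply, Finset.sum_apply]
      rw [hsum]
      refine sub_mem (const_mem_diffFamilies _) (sum_mem fun k hk => ?_)
      have hk := ih k (Finset.mem_range.1 hk)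
      exact smul_mem_diffFamilies (differentiableAt_wip hζ ℓ (const_mem_diffFamilies _) hk) hk
    have hne : Real.sqrt (wip ℓ ζ (preOrthPoly ℓ ζ n) (preOrthPoly ℓ ζ n)) ≠ 0 := fun h0 =>
      (isOrthonormal_orthPoly hζ ℓ).ne_zero n (by
        rw [orthPoly_eq_C_mul_preOrthPoly, h0, inv_zero, C_0, zero_mul])
    simp only [orthPoly_eq_C_mul_preOrthPoly ℓ _ n, ← smul_eq_C_mul]
    exact smul_mem_diffFamilies (((differentiableAt_wip hζ ℓ hq hq).sqrt
      fun h0 => hne (by rw [h0, Real.sqrt_zero])).fun_inv hne) hq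

end

/-- The logarithmic derivative of `g` with respect to the temperature, as a polynomial in `E`. -/
def thetaFactor (θ : ℝ) : ℝ[X] := C (θ⁻¹ ^ 2) * (X - C (weightFun 0 θ⁻¹ (X ^ 2)))

lemma hasDerivAt_expMom_X_inv_mul_exp {ζ : ℝ} (hζ : 0 < ζ) (x : ℝ) :
    HasDerivAt (fun s => (expMom s X)⁻¹ * Real.exp (-s * x))
      ((expMom ζ X)⁻¹ * Real.exp (-ζ * x) * (weightFun 0 ζ (X ^ 2) - x)) ζ := by
  have hX := (expMom_X_pos hζ).ne'
  refine (((hasDerivAt_expMom hζ X).fun_inv hX).fun_mul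
    (((hasDerivAt_id ζ).neg.mul_const x).exp)).congr_deriv ?_
  simp only [weightFun_zero_apply, Pi.neg_apply, id, ← pow_two]
  field_simp
  ring

section

variable {θ : ℝ} (hθ : 0 < θ)

include hθ

lemma hasDerivAt_gEq_theta (u p : ℝ) :
    HasDerivAt (fun t => gEq u t p) (gEq u θ p * (thetaFactor θ).eval (energy u p)) θ := by
  have heq : (fun t => gEq u t p) =ᶠ[nhds θ] fun t =>
      (expMom t⁻¹ X)⁻¹ * Real.exp (-t⁻¹ * energy u p) :=
    (eventually_gt_nhds hθ).mono fun t ht => gEq_eq ht u p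
  refine (((hasDerivAt_expMom_X_inv_mul_exp (inv_pos.2 hθ) _).comp θ
    (hasDerivAt_inv hθ.ne')).congr_of_eventuallyEq heq).congr_deriv ?_
  simp only [gEq_eq hθ, thetaFactor, eval_mul, eval_C, eval_sub, eval_X]
  ring

lemma hasDerivAt_shellFun_theta (v : ShellPoly) :
    HasDerivAt (fun t => shellFun t⁻¹ v) (shellFun θ⁻¹ (⟨thetaFactor θ, 0⟩ * v)) θ := by
  refine ((hasDerivAt_weightFun_zero (inv_pos.2 hθ) v.re).comp θ
    (hasDerivAt_inv hθ.ne')).congr_deriv ?_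
  rw [shellFun_mul, zero_mul, map_zero, add_zero, thetaFactor, mul_assoc, ← smul_eq_C_mul, map_smul,
    smul_eq_mul, inv_pow]
  ring

lemma hasDerivAt_shellDist_theta (u p : ℝ) (v : ShellPoly) :
    HasDerivAt (fun t => shellDist u t v p) (shellDist u θ (⟨thetaFactor θ, 0⟩ * v) p) θ := by
  refine ((hasDerivAt_gEq_theta hθ u p).mul_const _).congr_deriv ?_
  simp only [shellDist, shellEval_apply, QuadraticAlgebra.re_mul, QuadraticAlgebra.im_mul, zero_mul,
    mul_zero, add_zero, eval_mul]
  ring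

lemma exists_theta_derivative {V : ℝ → ShellPoly} (hV : V ∈ diffFamilies ShellPoly θ) :
    ∃ Θ : ShellPoly,
      (∀ u p, HasDerivAt (fun t => shellDist u t (V t) p) (shellDist u θ Θ p) θ) ∧
      ∀ y, HasDerivAt (fun t => shellFun t⁻¹ (V t * y)) (shellFun θ⁻¹ (Θ * y)) θ := by
  obtain ⟨V', hV'⟩ := exists_hasDerivAt_map hV
  refine ⟨V' + ⟨thetaFactor θ, 0⟩ * V θ, fun u p => ?_, fun y => ?_⟩
  · have h := hasDerivAt_shellDist_theta hθ u p
    refine (hV' (fun t => gEq u t p • shellEval (energy u p) (nmom u p))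
      fun v => (h v).differentiableAt).congr_deriv ?_
    rw [shellDist, map_add, mul_add]
    exact congrArg _ (h (V θ)).deriv
  · have h := fun v => hasDerivAt_shellFun_theta hθ (v * y)
    refine (hV' (fun t => shellFun t⁻¹ ∘ₗ LinearMap.mulRight ℝ y)
      fun v => (h v).differentiableAt).congr_deriv ?_
    rw [add_mul, map_add, mul_assoc]
    exact congrArg _ (h (V θ)).deriv

lemma shellBasis_mem_diffFamilies {M : ℕ} (b : Blk M) :
    (fun t => shellBasis M t⁻¹ b) ∈ diffFamilies ShellPoly θ := by
  have hinv : DifferentiableAt ℝ (fun t : ℝ => t⁻¹) θ := differentiableAt_inv hθ.ne'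
  have h := fun ℓ n => comp_mem_diffFamilies hinv (orthPoly_mem_diffFamilies (inv_pos.2 hθ) ℓ n)
  rcases b with k | k
  · have := map_mem_diffFamilies
      ((LinearMap.toSpanSingleton ℝ[X] ShellPoly ⟨1, 0⟩).restrictScalars ℝ) (h 0 k)
    simpa [shellBasis_inl]
  · have := map_mem_diffFamilies
      ((LinearMap.toSpanSingleton ℝ[X] ShellPoly ⟨0, 1⟩).restrictScalars ℝ) (h 1 k)
    simpa [shellBasis_inr]

end

/-! ### The projected distribution -/

/-- The position of a basis function in the interlaced ordering, as an equivalence. -/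
def blkEquiv (M : ℕ) : Blk M ≃ Fin (2 * M + 1) :=
  .ofBijective (Sum.elim (fun n => ⟨2 * n - 1, by omega⟩) fun n => ⟨2 * n + 2, by omega⟩) <| by
    refine (Fintype.bijective_iff_injective_and_card _).2
      ⟨?_, by simp only [Fintype.card_sum, Fintype.card_fin]; omega⟩
    rintro (m | m) (n | n) h <;>
      simp only [Sum.elim_inl, Sum.elim_inr, Sum.inl.injEq, Sum.inr.injEq,
        Fin.ext_iff] at h ⊢ <;> omega

lemma blkEquiv_inl {M : ℕ} (n : Fin (M + 1)) : (blkEquiv M (.inl n) : ℕ) = 2 * n - 1 := rfl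

lemma blkEquiv_inr {M : ℕ} (n : Fin M) : (blkEquiv M (.inr n) : ℕ) = 2 * n + 2 := rfl

lemma posPoly_blkEquiv_inl {M : ℕ} (ζ : ℝ) (n : Fin (M + 1)) :
    posPoly ζ (blkEquiv M (.inl n)) = orthPoly 0 ζ n := by
  have hpos : 2 * (n : ℕ) - 1 = 0 ∨ Odd (2 * (n : ℕ) - 1) := by
    rw [Nat.odd_iff]
    omega
  have hidx : (2 * (n : ℕ) - 1 + 1) / 2 = n := by omega
  rw [blkEquiv_inl, posPoly, if_pos hpos, hidx]

lemma posPoly_blkEquiv_inr {M : ℕ} (ζ : ℝ) (n : Fin M) :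
    posPoly ζ (blkEquiv M (.inr n)) = orthPoly 1 ζ n := by
  have hpos : ¬(2 * (n : ℕ) + 2 = 0 ∨ Odd (2 * (n : ℕ) + 2)) := by
    rw [Nat.odd_iff]
    omega
  have hidx : (2 * (n : ℕ) + 2) / 2 - 1 = n := by omega
  rw [blkEquiv_inr, posPoly, if_neg hpos, hidx]

lemma basisFn_blkEquiv {M : ℕ} (u θ : ℝ) (b : Blk M) :
    basisFn u θ (blkEquiv M b) = shellDist u θ (shellBasis M θ⁻¹ b) := by
  ext p
  rcases b with n | n
  · have hpos : 2 * (n : ℕ) - 1 = 0 ∨ Odd (2 * (n : ℕ) - 1) := by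
      rw [Nat.odd_iff]
      omega
    rw [basisFn, posPoly_blkEquiv_inl, blkEquiv_inl, if_pos hpos, shellDist, shellBasis_inl,
      shellEval_apply, eval_zero, mul_zero, add_zero]
  · have hpos : ¬(2 * (n : ℕ) + 2 = 0 ∨ Odd (2 * (n : ℕ) + 2)) := by
      rw [Nat.odd_iff]
      omega
    rw [basisFn, posPoly_blkEquiv_inr, blkEquiv_inr, if_neg hpos, shellDist, shellBasis_inr,
      shellEval_apply, eval_zero, zero_add, nmom]
    ring

namespace State

variable {M : ℕ}

/-- `State.comp` as a linear map. -/
def compLinear (M k : ℕ) : State M →ₗ[ℝ] ℝ where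
  toFun w := w.comp k
  map_add' v w := by
    simp only [comp]
    split_ifs <;> simp
  map_smul' c w := by
    simp only [comp]
    split_ifs <;> simp

lemma comp_coe (w : State M) (k : Fin (2 * M + 1)) : w.comp k = w k := by
  rw [comp, dif_pos k.2]

lemma comp_of_le (w : State M) {k : ℕ} (hk : 2 * M + 1 ≤ k) : w.comp k = 0 := by
  rw [comp, dif_neg (not_lt.2 hk)]

lemma comp_single (k : Fin (2 * M + 1)) (i : ℕ) :
    State.comp (Pi.single k 1 : State M) i = if (k : ℕ) = i then 1 else 0 := by
  simp only [comp, Pi.single_apply, Fin.ext_iff]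
  split_ifs <;> first | rfl | omega

lemma sum_ite_mul (w : State M) (i : ℕ) (c : ℝ) :
    ∑ k : Fin (2 * M + 1), (if (k : ℕ) = i then c else 0) * w k = c * w.comp i := by
  by_cases hi : i < 2 * M + 1
  · lift i to Fin (2 * M + 1) using hi
    simp [← Fin.ext_iff, comp_coe]
  · rw [w.comp_of_le (not_lt.1 hi), mul_zero]
    refine Finset.sum_eq_zero fun k _ => ?_
    rw [if_neg (by omega), zero_mul]

lemma update_eq_add_smul_single (W : State M) (k : Fin (2 * M + 1)) (s : ℝ) :
    Function.update W k s = W + (s - W k) • (Pi.single k 1 : State M) := by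
  ext j
  obtain rfl | h := eq_or_ne j k <;> simp [*]

lemma comp_update (W : State M) (k : Fin (2 * M + 1)) (s : ℝ) {i : ℕ} (hi : i < 2 * M + 1) :
    State.comp (Function.update W k s) i = if (k : ℕ) = i then s else W.comp i := by
  simp only [comp, dif_pos hi, Function.update_apply, Fin.ext_iff, eq_comm]

end State

lemma matDW_apply {M : ℕ} (θ : ℝ) (j k : Fin (2 * M + 1)) :
    matDW M θ j k =
      if (j : ℕ) < 5 then (if (k : ℕ) = 0 then if (j : ℕ) = 0 then (lc 0 θ⁻¹ 0)⁻¹ else 0 else 0) +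
        if (k : ℕ) = if (j : ℕ) = 2 ∨ (j : ℕ) = 4 then 4 else 3 then -(posPoly θ⁻¹ j).eval 0 else 0
      else if (k : ℕ) = j then 1 else 0 := by
  simp only [matDW, Fin.ext_iff]
  generalize posPoly θ⁻¹ j = f
  split_ifs <;> first | rfl | omega | simp

lemma matDW_mulVec {M : ℕ} (θ : ℝ) (w : State M) (j : Fin (2 * M + 1)) :
    (matDW M θ).mulVec w j =
      if (j : ℕ) < 5 then (if (j : ℕ) = 0 then (lc 0 θ⁻¹ 0)⁻¹ * w.comp 0 else 0) -
        (posPoly θ⁻¹ j).eval 0 * w.comp (if (j : ℕ) = 2 ∨ (j : ℕ) = 4 then 4 else 3)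
      else w.comp j := by
  change ∑ k, matDW M θ j k * w k = _
  simp only [matDW_apply θ j]
  split_ifs <;> simp only [add_mul, Finset.sum_add_distrib, w.sum_ite_mul] <;> ring

lemma matDW_mulVec_inl {M : ℕ} (θ : ℝ) (w : State M) (n : Fin (M + 1)) :
    (matDW M θ).mulVec w (blkEquiv M (.inl n)) =
      (if (n : ℕ) = 0 then (lc 0 θ⁻¹ 0)⁻¹ * w.comp 0 else 0) +
        if (n : ℕ) < 3 then -((orthPoly 0 θ⁻¹ n).eval 0 * w.comp 3) else w.comp (2 * n - 1) := by
  have h5 : 2 * (n : ℕ) - 1 < 5 ↔ (n : ℕ) < 3 := by omega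
  have h0 : 2 * (n : ℕ) - 1 = 0 ↔ (n : ℕ) = 0 := by omega
  have h24 : ¬(2 * (n : ℕ) - 1 = 2 ∨ 2 * (n : ℕ) - 1 = 4) := by omega
  rw [matDW_mulVec, posPoly_blkEquiv_inl]
  simp only [blkEquiv_inl, h5, h0, h24, if_false]
  split_ifs <;> first | ring1 | omega

lemma matDW_mulVec_inr {M : ℕ} (θ : ℝ) (w : State M) (n : Fin M) :
    (matDW M θ).mulVec w (blkEquiv M (.inr n)) =
      if (n : ℕ) < 2 then -((orthPoly 1 θ⁻¹ n).eval 0 * w.comp 4) else w.comp (2 * n + 2) := by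
  have h5 : 2 * (n : ℕ) + 2 < 5 ↔ (n : ℕ) < 2 := by omega
  have h0 : 2 * (n : ℕ) + 2 ≠ 0 := by omega
  have h24 : 2 * (n : ℕ) + 2 = 2 ∨ 2 * (n : ℕ) + 2 = 4 ↔ (n : ℕ) < 2 := by omega
  rw [matDW_mulVec, posPoly_blkEquiv_inr]
  simp only [blkEquiv_inr, h5, h0, h24, if_false, zero_sub]
  split_ifs <;> rfl

/-- The distribution with state `w` at temperature `θ`, divided by `g`, as a polynomial in `E` and
`(U⁰)⁻¹ p_{<1>}`. -/
def distPoly (M : ℕ) (θ : ℝ) : State M →ₗ[ℝ] ShellPoly :=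
  Fintype.linearCombination ℝ (shellBasis M θ⁻¹) ∘ₗ
    LinearMap.funLeft ℝ ℝ (blkEquiv M) ∘ₗ (matDW M θ).mulVecLin

lemma distPoly_apply {M : ℕ} (θ : ℝ) (w : State M) : distPoly M θ w =
    ∑ b, (matDW M θ).mulVec w (blkEquiv M b) • shellBasis M θ⁻¹ b := rfl

lemma distPoly_single {M : ℕ} (θ : ℝ) {k : Fin (2 * M + 1)} (hk : (k : ℕ) = 1 ∨ (k : ℕ) = 2) :
    distPoly M θ (Pi.single k 1) = 0 := by
  have h0 : (k : ℕ) ≠ 0 := by omega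
  have hcol : (matDW M θ).mulVec (Pi.single k 1) = 0 := by
    ext j
    rw [Matrix.mulVec_single_one, Matrix.col_apply, matDW, if_neg h0, if_pos hk, Pi.zero_apply]
  simp only [distPoly_apply, hcol, Pi.zero_apply, zero_smul, Finset.sum_const_zero]

lemma projDist_eq_shellDist {M : ℕ} (W : State M) :
    projDist W = shellDist W.vel W.theta (distPoly M W.theta W) := by
  ext p
  rw [projDist, ← (blkEquiv M).sum_comp]
  simp only [basisFn_blkEquiv, shellDist, distPoly_apply, map_sum, map_smul, smul_eq_mul,
    Finset.mul_sum]
  exact Finset.sum_congr rfl fun b _ => by ring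

lemma orthPoly_zero_eq_C_lc (ℓ : Fin 2) (ζ : ℝ) : orthPoly ℓ ζ 0 = C (lc ℓ ζ 0) := by
  have hC : orthPoly ℓ ζ 0 = C (Real.sqrt (wip ℓ ζ (preOrthPoly ℓ ζ 0) (preOrthPoly ℓ ζ 0)))⁻¹ := by
    rw [orthPoly_eq_C_mul_preOrthPoly]
    conv_lhs => enter [2]; rw [preOrthPoly, Finset.range_zero, Finset.sum_empty, sub_zero, pow_zero]
    rw [mul_one]
  rw [lc, hC, leadingCoeff_C]

lemma differentiableAt_matDW_mulVec {M : ℕ} {θ : ℝ} (hθ : 0 < θ) (w : State M) (b : Blk M) :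
    DifferentiableAt ℝ (fun t => (matDW M t).mulVec w (blkEquiv M b)) θ := by
  have hζ := inv_pos.2 hθ
  have heval : ∀ ℓ n, DifferentiableAt ℝ (fun t => (orthPoly ℓ t⁻¹ n).eval 0) θ := fun ℓ n => by
    obtain ⟨V', hV'⟩ := exists_hasDerivAt_map (orthPoly_mem_diffFamilies hζ ℓ n)
    exact (hV' (fun _ => leval 0) fun e =>
      differentiableAt_const _).differentiableAt.fun_comp' θ (differentiableAt_inv hθ.ne')
  have hlc : DifferentiableAt ℝ (fun t => (lc 0 t⁻¹ 0)⁻¹) θ := by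
    have hne := (isOrthonormal_orthPoly hζ 0).leadingCoeff_pos 0
    have h0 := heval 0 0
    simp only [orthPoly_zero_eq_C_lc, eval_C] at h0
    exact h0.fun_inv hne.ne'
  rcases b with n | n
  · simp only [matDW_mulVec_inl]
    split_ifs <;> fun_prop
  · simp only [matDW_mulVec_inr]
    split_ifs <;> fun_prop

lemma distPoly_mem_diffFamilies {M : ℕ} {θ : ℝ} (hθ : 0 < θ) (w : State M) :
    (fun t => distPoly M t w) ∈ diffFamilies ShellPoly θ := by
  have hsum : (fun t => distPoly M t w) =
      ∑ b, fun t => (matDW M t).mulVec w (blkEquiv M b) • shellBasis M t⁻¹ b :=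
    funext fun t => by rw [distPoly_apply, Finset.sum_apply]
  rw [hsum]
  exact sum_mem fun b _ => smul_mem_diffFamilies (differentiableAt_matDW_mulVec hθ w b)
    (shellBasis_mem_diffFamilies hθ b)

lemma IsOrthonormal.sum_ite_mul_map {Λ : ℝ[X] →ₗ[ℝ] ℝ} {P : ℕ → ℝ[X]} (h : IsOrthonormal Λ P)
    {d N : ℕ} {c : ℝ} (hc : N < d → c = 0) {f : ℝ[X]} (hf : f.degree < d) (a : ℕ → ℝ) (x : ℝ) :
    ∑ n : Fin N, (if (n : ℕ) < d then -((P n).eval x * c) else a n) * Λ (f * P n) =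
      -(c * f.eval x) := by
  have hterm : ∀ n : ℕ, (if n < d then -((P n).eval x * c) else a n) * Λ (f * P n) =
      -c * (Λ (f * P n) * (P n).eval x) := fun n => by
    split_ifs with hn
    · ring
    · rw [h.map_mul_eq_zero (hf.trans_le (Nat.cast_le.2 (not_lt.1 hn)))]
      ring
  simp only [hterm, ← Finset.mul_sum]
  rcases lt_or_ge N d with hN | hN
  · rw [hc hN, neg_zero, zero_mul, zero_mul, neg_zero]
  · rw [← Finset.sum_range fun n => Λ (f * P n) * (P n).eval x]
    conv_rhs => rw [h.expansion (hf.trans_le (Nat.cast_le.2 hN))]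
    simp only [eval_finsetSum, eval_smul, smul_eq_mul, neg_mul]

lemma shellFun_distPoly_mul {M : ℕ} {θ : ℝ} (hθ : 0 < θ) (w : State M) {v : ShellPoly}
    (hv : v ∈ shellSpace 2) : shellFun θ⁻¹ (distPoly M θ w * v) =
      w.comp 0 * weightFun 0 θ⁻¹ v.re - w.comp 3 * v.re.eval 0 - w.comp 4 * v.im.eval 0 := by
  have hζ := inv_pos.2 hθ
  have h0 := (isOrthonormal_orthPoly hζ 0).sum_ite_mul_map (N := M + 1) (c := w.comp 3)
    (fun hM => w.comp_of_le (by omega)) hv.1 (fun n => w.comp (2 * n - 1)) 0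
  have h1 := (isOrthonormal_orthPoly hζ 1).sum_ite_mul_map (N := M) (c := w.comp 4)
    (fun hM => w.comp_of_le (by omega)) hv.2 (fun n => w.comp (2 * n + 2)) 0
  have hdens : ∑ n : Fin (M + 1), (if (n : ℕ) = 0 then (lc 0 θ⁻¹ 0)⁻¹ * w.comp 0 else 0) *
      weightFun 0 θ⁻¹ (v.re * orthPoly 0 θ⁻¹ n) = w.comp 0 * weightFun 0 θ⁻¹ v.re := by
    have hlc : lc 0 θ⁻¹ 0 ≠ 0 := ((isOrthonormal_orthPoly hζ 0).leadingCoeff_pos 0).ne'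
    rw [Finset.sum_eq_single 0 (fun n _ hn => by rw [if_neg (Fin.val_ne_zero_iff.2 hn), zero_mul])
      (by simp), Fin.val_zero, if_pos rfl, orthPoly_zero_eq_C_lc, mul_comm v.re, ← smul_eq_C_mul,
      map_smul, smul_eq_mul, mul_mul_mul_comm, inv_mul_cancel₀ hlc, one_mul]
  simp only [distPoly_apply, Finset.sum_mul, map_add, map_sum, smul_mul_assoc, map_smul,
    smul_eq_mul, Fintype.sum_sum_type, shellFun_mul, matDW_mulVec_inl, matDW_mulVec_inr,
    shellBasis_inl, shellBasis_inr, zero_mul, map_zero, add_zero, zero_add, add_mul,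
    Finset.sum_add_distrib, mul_comm (orthPoly _ _ _) _]
  rw [hdens, h0, h1]
  ring

/-- The derivative of the projected distribution in the direction `w`, where `Θ` is its derivative
with respect to the temperature. -/
def tangentPoly {M : ℕ} (W : State M) (Θ : ShellPoly) : State M →ₗ[ℝ] ShellPoly :=
  distPoly M W.theta + (State.compLinear M 1).smulRight
    (U0 W.vel ^ 2 • velDeriv W.theta⁻¹ (distPoly M W.theta W)) +
    (State.compLinear M 2).smulRight Θ

lemma tangentPoly_apply {M : ℕ} (W : State M) (Θ : ShellPoly) (w : State M) :
    tangentPoly W Θ w = distPoly M W.theta w +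
      w.comp 1 • U0 W.vel ^ 2 • velDeriv W.theta⁻¹ (distPoly M W.theta W) + w.comp 2 • Θ := rfl

section

variable {M : ℕ} (hM : 1 ≤ M) (W : State M) (hu : |W.vel| < 1) (hθ : 0 < W.theta) {Θ : ShellPoly}
  (hΘ : ∀ u p, HasDerivAt (fun t => shellDist u t (distPoly M t W) p)
    (shellDist u W.theta Θ p) W.theta)

include hM hu hθ hΘ

lemma hasDerivAt_projDist_update (k : Fin (2 * M + 1)) (p : ℝ) :
    HasDerivAt (fun s => projDist (M := M) (Function.update W k s) p)
      (shellDist W.vel W.theta (tangentPoly W Θ (Pi.single k 1)) p) (W k) := by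
  have hvel : ∀ s, State.vel (Function.update W k s) = if (k : ℕ) = 1 then s else W.vel :=
    fun s => W.comp_update k s (by omega)
  have htheta : ∀ s, State.theta (Function.update W k s) = if (k : ℕ) = 2 then s else W.theta :=
    fun s => W.comp_update k s (by omega)
  simp only [projDist_eq_shellDist, hvel, htheta, tangentPoly_apply, State.comp_single]
  simp only [W.update_eq_add_smul_single, map_add, map_smul]
  by_cases h1 : (k : ℕ) = 1
  · have hWk : W k = W.vel := by rw [State.vel, ← h1, W.comp_coe]
    simp only [h1, distPoly_single _ (.inl h1), smul_zero, add_zero, zero_add, if_true, one_smul,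
      OfNat.one_ne_ofNat, if_false, zero_smul, hWk]
    exact hasDerivAt_shellDist_vel hu hθ _ p
  by_cases h2 : (k : ℕ) = 2
  · have hWk : W k = W.theta := by rw [State.theta, ← h2, W.comp_coe]
    simp only [h2, distPoly_single _ (.inr h2), smul_zero, add_zero, zero_add, if_true, one_smul,
      OfNat.ofNat_ne_one, if_false, zero_smul, hWk]
    exact hΘ _ p
  · simp only [h1, h2, if_false, zero_smul, add_zero, shellDist, map_add, map_smul, smul_eq_mul]
    refine ((((hasDerivAt_id _).sub_const _).mul_const _).const_add _ |>.const_mul _).congr_deriv ?_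
    rw [one_mul]

lemma matD_mulVec (w : State M) (b : Blk M) : (matD W).mulVec w (blkEquiv M b) =
    shellFun W.theta⁻¹ (tangentPoly W Θ w * shellBasis M W.theta⁻¹ b) := by
  have hentry : ∀ k, matD W (blkEquiv M b) k =
      shellFun W.theta⁻¹ (tangentPoly W Θ (Pi.single k 1) * shellBasis M W.theta⁻¹ b) := fun k => by
    rw [matD, basisFn_blkEquiv, ← gip_shellDist hθ hu]
    congr 1
    exact funext fun p => (hasDerivAt_projDist_update hM W hu hθ hΘ k p).deriv
  have hw : w = ∑ k, w k • (Pi.single k 1 : State M) := pi_eq_sum_univ' w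
  conv_rhs => rw [hw]
  simp only [map_sum, map_smul, Finset.sum_mul, smul_mul_assoc, ← hentry, smul_eq_mul]
  exact dotProduct_comm _ w

end

/-! ### Invertibility of `D_M` -/

lemma IsPositiveOn.sq_map_X_mul_lt {Λ : ℝ[X] →ₗ[ℝ] ℝ} {s : Set ℝ} (hΛ : IsPositiveOn Λ s)
    {f : ℝ[X]} (hf : f ≠ 0) (hnonneg : ∀ x ∈ s, 0 ≤ f.eval x) :
    Λ (X * f) ^ 2 < Λ f * Λ (X ^ 2 * f) := by
  have h0 := hΛ f hf hnonneg
  set c := Λ (X * f) / Λ f with hc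
  have h1 : 0 < Λ (f * (X - C c) ^ 2) :=
    hΛ _ (mul_ne_zero hf (pow_ne_zero 2 (X_sub_C_ne_zero c))) fun x hx => by
      rw [eval_mul, eval_pow]
      exact mul_nonneg (hnonneg x hx) (sq_nonneg _)
  have hexpand : f * (X - C c) ^ 2 = X ^ 2 * f - (2 * c) • (X * f) + c ^ 2 • f := by
    simp only [smul_eq_C_mul, map_mul, map_pow, map_ofNat]
    ring
  have hXf : Λ (X * f) = c * Λ f := by rw [hc, div_mul_cancel₀ _ h0.ne']
  rw [hexpand, map_add, map_sub, map_smul, map_smul, smul_eq_mul, smul_eq_mul, hXf] at h1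
  rw [hXf]
  nlinarith

lemma weightFun_thetaFactor_mul (θ : ℝ) (f : ℝ[X]) : weightFun 0 θ⁻¹ (thetaFactor θ * f) =
    θ⁻¹ ^ 2 * (weightFun 0 θ⁻¹ (X * f) - weightFun 0 θ⁻¹ (X ^ 2) * weightFun 0 θ⁻¹ f) := by
  rw [thetaFactor, mul_assoc, sub_mul, ← smul_eq_C_mul, ← smul_eq_C_mul, map_smul, map_sub,
    map_smul, smul_eq_mul, smul_eq_mul]

section

variable {θ : ℝ} (hθ : 0 < θ)

include hθ

lemma weightFun_zero_X : weightFun 0 θ⁻¹ X = 1 := by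
  rw [weightFun_zero_apply, inv_mul_cancel₀ (expMom_X_pos (inv_pos.2 hθ)).ne']

lemma weightFun_zero_X_sq_sub_one : weightFun 0 θ⁻¹ (X ^ 2 - 1) = θ := by
  have h := shellFun_boost (inv_pos.2 hθ) ⟨0, 1⟩
  rw [shellFun_mul] at h
  simp only [boost, shellFun_apply, derivative_one, mul_one, mul_zero, add_zero, map_zero, zero_add,
    weightFun_one_apply, weightFun_zero_X hθ] at h
  rw [mul_comm, ← smul_eq_C_mul, map_smul, smul_eq_mul, ← div_eq_inv_mul] at h
  exact ((div_eq_one_iff_eq hθ.ne').1 h.symm)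

lemma weightFun_thetaFactor_mul_X : weightFun 0 θ⁻¹ (thetaFactor θ * X) = 0 := by
  rw [weightFun_thetaFactor_mul, weightFun_zero_X hθ, mul_one, ← sq, sub_self, mul_zero]

lemma weightFun_thetaFactor_ne_zero : weightFun 0 θ⁻¹ (thetaFactor θ) ≠ 0 := by
  have h := (isPositiveOn_weightFun (inv_pos.2 hθ) 0).sq_map_X_mul_lt (f := 1) one_ne_zero
    fun x _ => by rw [eval_one]; exact zero_le_one
  rw [mul_one, mul_one, weightFun_zero_X hθ] at h
  rw [← mul_one (thetaFactor θ), weightFun_thetaFactor_mul, mul_one, weightFun_zero_X hθ]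
  exact mul_ne_zero (pow_ne_zero 2 (inv_ne_zero hθ.ne')) (ne_of_lt (by linarith))

lemma weightFun_thetaFactor_mul_X_sq_ne_zero :
    weightFun 0 θ⁻¹ (thetaFactor θ * X ^ 2) ≠ 0 := by
  have h := (isPositiveOn_weightFun (inv_pos.2 hθ) 0).sq_map_X_mul_lt (f := X) X_ne_zero
    fun x hx => by rw [eval_X]; exact zero_le_one.trans hx
  rw [weightFun_zero_X hθ, one_mul, ← sq, ← pow_succ] at h
  rw [weightFun_thetaFactor_mul, ← pow_succ', ← sq]
  exact mul_ne_zero (pow_ne_zero 2 (inv_ne_zero hθ.ne')) (ne_of_gt (sub_pos.2 h))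

end

lemma boost_mem_shellSpace {M : ℕ} {v : ShellPoly} (hv : v ∈ shellSpace M) :
    boost v ∈ shellSpace M := by
  obtain ⟨hre, him⟩ := hv
  rw [degree_lt_iff_coeff_zero] at hre him
  refine ⟨(degree_lt_iff_coeff_zero _ _).2 fun k hk => ?_,
    (degree_lt_iff_coeff_zero _ _).2 fun k hk => ?_⟩
  · obtain ⟨k, rfl⟩ := Nat.exists_eq_add_of_le' (le_of_add_le_right hk)
    have hX : (X * (X * derivative v.im)).coeff (k + 1) = 0 := by
      rcases k with - | k
      · rw [coeff_X_mul, coeff_X_mul_zero]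
      · rw [coeff_X_mul, coeff_X_mul, coeff_derivative, him _ (by omega), zero_mul]
    change (X * v.im + (X ^ 2 - 1) * derivative v.im).coeff (k + 1) = 0
    generalize v.im = f at him hX ⊢
    rw [sub_mul, sq, mul_assoc, coeff_add, coeff_sub, hX, coeff_X_mul, one_mul, coeff_derivative,
      him _ (by omega), him _ (by omega), zero_mul, sub_zero, add_zero]
  · rw [boost, coeff_derivative, hre _ (by omega), zero_mul]

lemma shellFun_theta_mul {M : ℕ} {θ : ℝ} (hθ : 0 < θ) (w : State M) {v Θ : ShellPoly}
    (hv : v ∈ shellSpace 2) (hΘ : HasDerivAt (fun t => shellFun t⁻¹ (distPoly M t w * v))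
      (shellFun θ⁻¹ (Θ * v)) θ) :
    shellFun θ⁻¹ (Θ * v) = w.comp 0 * weightFun 0 θ⁻¹ (thetaFactor θ * v.re) := by
  have h := (((hasDerivAt_shellFun_theta hθ v).const_mul (w.comp 0)).sub_const
    (w.comp 3 * v.re.eval 0)).sub_const (w.comp 4 * v.im.eval 0)
  have heq := hΘ.unique (h.congr_of_eventuallyEq
    ((eventually_gt_nhds hθ).mono fun t ht => shellFun_distPoly_mul ht w hv))
  rw [heq, shellFun_mul, zero_mul, map_zero, add_zero]

section

variable {M : ℕ} {W : State M} (hθ : 0 < W.theta) {Θ : ShellPoly}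
  (hΘ : ∀ v, HasDerivAt (fun t => shellFun t⁻¹ (distPoly M t W * v))
    (shellFun W.theta⁻¹ (Θ * v)) W.theta)

include hθ hΘ

lemma shellFun_tangentPoly_mul (w : State M) {v : ShellPoly} (hv : v ∈ shellSpace 2) :
    shellFun W.theta⁻¹ (tangentPoly W Θ w * v) =
      w.comp 0 * weightFun 0 W.theta⁻¹ v.re - w.comp 3 * v.re.eval 0 - w.comp 4 * v.im.eval 0 -
        w.comp 1 * U0 W.vel ^ 2 * (W.rho * weightFun 0 W.theta⁻¹ (boost v).re -
          W.bulk * (boost v).re.eval 0 - W.comp 4 * (boost v).im.eval 0) +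
        w.comp 2 * (W.rho * weightFun 0 W.theta⁻¹ (thetaFactor W.theta * v.re)) := by
  simp only [tangentPoly_apply, add_mul, smul_mul_assoc, map_add, map_smul, smul_eq_mul,
    shellFun_distPoly_mul hθ w hv, shellFun_velDeriv_mul (inv_pos.2 hθ),
    shellFun_distPoly_mul hθ W (boost_mem_shellSpace hv), shellFun_theta_mul hθ W hv (hΘ v),
    State.rho, State.bulk]
  ring

variable {w : State M}
  (hw : ∀ v ∈ shellSpace M, shellFun W.theta⁻¹ (tangentPoly W Θ w * v) = 0)

include hw

lemma kernel_moment_re {f : ℝ[X]} (hM : f.natDegree ≤ M) (h2 : f.natDegree ≤ 2) :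
    w.comp 0 * weightFun 0 W.theta⁻¹ f - w.comp 3 * f.eval 0 +
      w.comp 1 * U0 W.vel ^ 2 * (W.comp 4 * (derivative f).eval 0) +
        w.comp 2 * (W.rho * weightFun 0 W.theta⁻¹ (thetaFactor W.theta * f)) = 0 := by
  have hmem : ∀ {N}, f.natDegree ≤ N → ⟨f, 0⟩ ∈ shellSpace N := fun h => mem_shellSpace.2
    ⟨degree_le_natDegree.trans_lt (Nat.cast_lt.2 (Nat.lt_succ_of_le h)),
      degree_zero.trans_lt (WithBot.bot_lt_natCast _)⟩
  have h := hw _ (hmem hM)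
  rw [shellFun_tangentPoly_mul hθ hΘ w (hmem h2)] at h
  simp only [boost, mul_zero, map_zero, add_zero, eval_zero] at h
  linear_combination h

lemma kernel_moment_im {f : ℝ[X]} (hM : f.natDegree < M) (h2 : f.natDegree < 2) :
    w.comp 4 * f.eval 0 + w.comp 1 * U0 W.vel ^ 2 *
      (W.rho * weightFun 0 W.theta⁻¹ (X * f + (X ^ 2 - 1) * derivative f) +
        W.bulk * (derivative f).eval 0) = 0 := by
  have hmem : ∀ {N}, f.natDegree < N → ⟨0, f⟩ ∈ shellSpace N := fun h => mem_shellSpace.2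
    ⟨degree_zero.trans_lt (WithBot.bot_lt_natCast _),
      degree_le_natDegree.trans_lt (Nat.cast_lt.2 h)⟩
  have h := hw _ (hmem hM)
  rw [shellFun_tangentPoly_mul hθ hΘ w (hmem h2)] at h
  simp only [boost, mul_zero, map_zero, eval_zero, eval_add, eval_mul, eval_X, eval_sub, eval_pow,
    eval_one] at h
  linear_combination -h

variable (hM : 1 ≤ M)

include hM

lemma kernel_comp_one_eq_zero (hρ : 0 < W.rho) (hu : |W.vel| < 1)
    (hbulk : -(W.rho * W.theta) < W.bulk) : w.comp 1 = 0 := by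
  have hU : U0 W.vel ^ 2 ≠ 0 := pow_ne_zero 2 (U0_pos hu).ne'
  obtain rfl | hM2 := hM.eq_or_lt
  · have h := kernel_moment_im hθ hΘ hw (f := 1) (by simp) (by simp)
    simp only [w.comp_of_le (k := 4) (by norm_num), derivative_one, mul_one, mul_zero, add_zero,
      weightFun_zero_X hθ, eval_zero, zero_mul, zero_add, mul_assoc, mul_eq_zero, hU, hρ.ne',
      or_false] at h
    exact h
  · have h := kernel_moment_im hθ hΘ hw (natDegree_X.trans_lt hM2) (natDegree_X.trans_lt one_lt_two)
    have hXX : 0 < weightFun 0 W.theta⁻¹ (X ^ 2) :=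
      (isPositiveOn_weightFun (inv_pos.2 hθ) 0).map_sq_pos X_ne_zero
    have hne : W.rho * (weightFun 0 W.theta⁻¹ (X ^ 2) + W.theta) + W.bulk ≠ 0 := by
      nlinarith [mul_pos hρ hXX]
    simp only [eval_X, mul_zero, zero_add, derivative_X, eval_one, mul_one, ← sq, map_add,
      weightFun_zero_X_sq_sub_one hθ, mul_eq_zero, hU, hne, or_false] at h
    exact h

variable (h1 : w.comp 1 = 0)

include h1

lemma kernel_comp_zero_eq_zero : w.comp 0 = 0 := by
  have h := kernel_moment_re hθ hΘ hw (natDegree_X.trans_le hM) (natDegree_X.trans_le one_le_two)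
  simpa [h1, weightFun_zero_X hθ, weightFun_thetaFactor_mul_X hθ] using h

lemma kernel_comp_two_eq_zero (hρ : 0 < W.rho) : w.comp 2 = 0 := by
  have h0 := kernel_comp_zero_eq_zero hθ hΘ hw hM h1
  obtain rfl | hM2 := hM.eq_or_lt
  · have h := kernel_moment_re hθ hΘ hw (f := 1) (by simp) (by simp)
    simpa only [h0, h1, w.comp_of_le (k := 3) (by norm_num), zero_mul, sub_zero, zero_add,
      mul_one, mul_eq_zero, hρ.ne', weightFun_thetaFactor_ne_zero hθ, or_false] using h
  · have h := kernel_moment_re hθ hΘ hw (f := X ^ 2) ((natDegree_X_pow 2).trans_le hM2)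
      (natDegree_X_pow 2).le
    simpa [h0, h1, hρ.ne', weightFun_thetaFactor_mul_X_sq_ne_zero hθ] using h

lemma kernel_comp_three_eq_zero (hρ : 0 < W.rho) : w.comp 3 = 0 := by
  have h := kernel_moment_re hθ hΘ hw (f := 1) (by simp) (by simp)
  simpa [h1, kernel_comp_zero_eq_zero hθ hΘ hw hM h1,
    kernel_comp_two_eq_zero hθ hΘ hw hM h1 hρ] using h

lemma kernel_comp_four_eq_zero : w.comp 4 = 0 := by
  have h := kernel_moment_im hθ hΘ hw (natDegree_one.trans_lt hM) (by simp)
  simpa [h1] using h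

end

theorem isUnit_det_matD {M : ℕ} (hM : 1 ≤ M) (W : State M) (hρ : 0 < W.rho) (hu : |W.vel| < 1)
    (hθ : 0 < W.theta) (hbulk : -(W.rho * W.theta) < W.bulk) : IsUnit (matD W).det := by
  have hζ := inv_pos.2 hθ
  obtain ⟨Θ, hdist, hfun⟩ := exists_theta_derivative hθ (distPoly_mem_diffFamilies hθ W)
  rw [isUnit_iff_ne_zero]
  intro hdet
  obtain ⟨w, hne, hw⟩ := Matrix.exists_mulVec_eq_zero_iff.2 hdet
  have hbasis : ∀ b, shellFun W.theta⁻¹ (tangentPoly W Θ w * shellBasis M W.theta⁻¹ b) = 0 :=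
    fun b => by rw [← matD_mulVec hM W hu hθ hdist, hw, Pi.zero_apply]
  have hmoment : ∀ v ∈ shellSpace M, shellFun W.theta⁻¹ (tangentPoly W Θ w * v) = 0 :=
    fun v hv => by
      have h := map_eq_sum_shellBasis hζ (shellFun W.theta⁻¹ ∘ₗ LinearMap.mulLeft ℝ
        (tangentPoly W Θ w)) hv
      simpa [hbasis] using h
  have h1 := kernel_comp_one_eq_zero hθ hfun hmoment hM hρ hu hbulk
  have h0 := kernel_comp_zero_eq_zero hθ hfun hmoment hM h1
  have h2 := kernel_comp_two_eq_zero hθ hfun hmoment hM h1 hρ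
  have h3 := kernel_comp_three_eq_zero hθ hfun hmoment hM h1 hρ
  have h4 := kernel_comp_four_eq_zero hθ hfun hmoment hM h1
  refine hne (funext fun j => ?_)
  rw [← State.comp_coe w, Pi.zero_apply]
  rcases lt_or_ge (j : ℕ) 5 with hj | hj
  · interval_cases (j : ℕ) <;> assumption
  · obtain ⟨b, rfl⟩ := (blkEquiv M).surjective j
    have hb := hbasis b
    rw [tangentPoly_apply, h1, h2, zero_smul, zero_smul, add_zero, add_zero, distPoly_apply,
      shellFun_sum_smul_mul_shellBasis hζ, matDW_mulVec, if_neg (not_lt.2 hj)] at hb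
    exact hb

/-! ### The moment system -/

lemma permMat_eq_submatrix (M : ℕ) : permMat M = (1 : Matrix _ _ ℝ).submatrix id (blkEquiv M) := by
  ext j (n | n) <;>
    exact if_congr (by simp [Fin.ext_iff, blkEquiv_inl, blkEquiv_inr]) rfl rfl

lemma permMat_mul_transpose (M : ℕ) : permMat M * (permMat M).transpose = 1 := by
  rw [permMat_eq_submatrix, Matrix.transpose_submatrix, Matrix.submatrix_mul_equiv,
    Matrix.transpose_one, Matrix.mul_one, Matrix.submatrix_id_id]

lemma permMat_transpose_mul (M : ℕ) : (permMat M).transpose * permMat M = 1 := by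
  rw [permMat_eq_submatrix, Matrix.transpose_submatrix, Matrix.transpose_one,
    ← Matrix.submatrix_mul _ _ _ _ _ Function.bijective_id, Matrix.one_mul,
    Matrix.submatrix_one_equiv]

lemma matMt_eq (M : ℕ) (u θ : ℝ) : matMt M u θ =
    permMat M * (U0 u • matA0 M θ⁻¹ - U1 u • matA1 M θ⁻¹) * (permMat M).transpose := by
  rw [matMt, Matrix.mul_sub, Matrix.sub_mul, Matrix.mul_smul, Matrix.mul_smul, Matrix.smul_mul,
    Matrix.smul_mul, neg_smul, neg_add_eq_sub]

lemma matMx_eq (M : ℕ) (u θ : ℝ) : matMx M u θ =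
    permMat M * (U1 u • matA0 M θ⁻¹ - U0 u • matA1 M θ⁻¹) * (permMat M).transpose := by
  rw [matMx, Matrix.mul_sub, Matrix.sub_mul, Matrix.mul_smul, Matrix.mul_smul, Matrix.smul_mul,
    Matrix.smul_mul, neg_smul, neg_add_eq_sub]

lemma one_sub_mul_pos {u a : ℝ} (hu : |u| < 1) (ha : |a| < 1) : 0 < 1 - u * a := by
  have habs : |u * a| < 1 := by
    rw [abs_mul]
    exact mul_lt_one_of_nonneg_of_lt_one_left (abs_nonneg u) hu ha.le
  exact sub_pos.2 ((le_abs_self _).trans_lt habs)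

lemma abs_mobius_lt_one {u a : ℝ} (hu : |u| < 1) (ha : |a| < 1) :
    |(u - a) / (1 - u * a)| < 1 := by
  have h := one_sub_mul_pos hu ha
  rw [abs_div, abs_of_pos h, div_lt_one h, abs_lt]
  rw [abs_lt] at hu ha
  constructor <;> nlinarith

lemma injOn_mobius {u : ℝ} (hu : |u| < 1) :
    Set.InjOn (fun a => (u - a) / (1 - u * a)) {a | |a| < 1} := by
  intro a ha b hb hab
  rw [div_eq_div_iff (one_sub_mul_pos hu ha).ne' (one_sub_mul_pos hu hb).ne'] at hab
  have hmul : (1 - u ^ 2) * (a - b) = 0 := by linear_combination -hab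
  exact sub_eq_zero.1 ((mul_eq_zero.1 hmul).resolve_left (one_sub_sq_pos hu).ne')

section

variable {ι : Type} [Fintype ι] [DecidableEq ι] {M : ℕ} {A0 A1 : Matrix ι ι ℝ} {μ : ℤ → ℝ}
  {y : ℤ → ι → ℝ} (h : IsEigenSystem M A0 A1 μ y)

include h

lemma IsEigenSystem.boost (hcard : Fintype.card ι = 2 * M + 1) {u : ℝ} (hu : |u| < 1)
    (hμ : ∀ i ∈ Set.Icc (-(M : ℤ)) M, |μ i| < 1) (hdet : IsUnit (U0 u • A0 - U1 u • A1).det) :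
    IsEigenSystem M (U0 u • A0 - U1 u • A1) (U1 u • A0 - U0 u • A1)
      (fun i => (u - μ i) / (1 - u * μ i)) y := by
  refine isEigenSystem_of_eigen hcard hdet ((injOn_mobius hu).comp h.injOn hμ) h.ne_zero
    fun i hi => ?_
  have hpos := one_sub_mul_pos hu (hμ i hi)
  rw [Matrix.sub_mulVec, Matrix.sub_mulVec, Matrix.smul_mulVec, Matrix.smul_mulVec,
    Matrix.smul_mulVec, Matrix.smul_mulVec, h.eigen i hi, smul_smul, smul_smul, ← sub_smul,
    ← sub_smul, smul_smul, U1_eq]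
  congr 1
  field_simp

lemma IsEigenSystem.mul_mul {κ : Type} [Fintype κ] [DecidableEq κ]
    {P S : Matrix κ ι ℝ} {R : Matrix ι κ ℝ} (hPdet : IsUnit (P * A0 * R).det) (hRS : R * S = 1)
    (hκ : Fintype.card κ = 2 * M + 1) :
    IsEigenSystem M (P * A0 * R) (P * A1 * R) μ fun i => S.mulVec (y i) := by
  have hinv : ∀ i, R.mulVec (S.mulVec (y i)) = y i := fun i => by
    rw [Matrix.mulVec_mulVec, hRS, Matrix.one_mulVec]
  refine isEigenSystem_of_eigen hκ hPdet h.injOn (fun i hi hi0 => h.ne_zero i hi ?_) fun i hi => ?_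
  · rw [← hinv i, hi0, Matrix.mulVec_zero]
  · rw [← Matrix.mulVec_mulVec, ← Matrix.mulVec_mulVec, hinv, ← Matrix.mulVec_mulVec,
      hinv, ← Matrix.mulVec_mulVec, h.eigen i hi, Matrix.mulVec_smul, Matrix.mulVec_mulVec]

end

section

variable {M : ℕ} {W : State M} (hu : |W.vel| < 1) (hθ : 0 < W.theta)

include hu hθ

lemma isUnit_det_boost_matA0 :
    IsUnit (U0 W.vel • matA0 M W.theta⁻¹ - U1 W.vel • matA1 M W.theta⁻¹).det := by
  rw [U1_eq, mul_comm, mul_smul, ← smul_sub, Matrix.det_smul]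
  exact ((U0_pos hu).ne'.isUnit.pow _).mul
    (posDef_matA0_sub_smul_matA1 (inv_pos.2 hθ) hu M).det_pos.ne'.isUnit

lemma isUnit_det_matMt : IsUnit (matMt M W.vel W.theta).det := by
  rw [matMt_eq, Matrix.det_conj_of_mul_eq_one (permMat_mul_transpose M) (permMat_transpose_mul M)]
  exact isUnit_det_boost_matA0 hu hθ

theorem isEigenSystem_moment (hM : 1 ≤ M) (hD : IsUnit (matD W).det) {z : ℤ → ℝ}
    (hz : IsZeroList M W.theta⁻¹ z) :
    IsEigenSystem M (matB0 W) (matB1 W) (lam W.vel z) (eigVec W z) := by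
  have hcard : Fintype.card (Blk M) = 2 * M + 1 := by
    rw [Fintype.card_sum, Fintype.card_fin, Fintype.card_fin]
    omega
  have hboost := (hz.isEigenSystem_pair (inv_pos.2 hθ) hM).boost hcard hu
    (fun i hi => hz.abs_lamHat_lt_one hi) (isUnit_det_boost_matA0 hu hθ)
  have hinv : (permMat M).transpose * matD W * ((matD W)⁻¹ * permMat M) = 1 := by
    rw [Matrix.mul_assoc, Matrix.mul_nonsing_inv_cancel_left _ _ hD, permMat_transpose_mul]
  have hB0 : matB0 W = permMat M * (U0 W.vel • matA0 M W.theta⁻¹ - U1 W.vel • matA1 M W.theta⁻¹) *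
      ((permMat M).transpose * matD W) := by
    rw [matB0, matMt_eq, Matrix.mul_assoc _ (permMat M).transpose]
  have hB1 : matB1 W = permMat M * (U1 W.vel • matA0 M W.theta⁻¹ - U0 W.vel • matA1 M W.theta⁻¹) *
      ((permMat M).transpose * matD W) := by
    rw [matB1, matMx_eq, Matrix.mul_assoc _ (permMat M).transpose]
  have hdet : IsUnit (matB0 W).det := by
    rw [matB0, Matrix.det_mul]
    exact (isUnit_det_matMt hu hθ).mul hD
  rw [hB0] at hdet
  rw [hB0, hB1]
  exact hboost.mul_mul hdet hinv (Fintype.card_fin _)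

end

end RelMoment

end

theorem mainTheorem2 (M : ℕ) (hM : 1 ≤ M) (W : RelMoment.State M)
    (hρ : 0 < W.rho) (hu : |W.vel| < 1) (hθ : 0 < W.theta)
    (hbulk : -(W.rho * W.theta) < W.bulk) :
    ∃ z : ℤ → ℝ, RelMoment.IsZeroList M W.theta⁻¹ z ∧
      RelMoment.IsEigenSystem M (RelMoment.matA0 M W.theta⁻¹) (RelMoment.matA1 M W.theta⁻¹)
        (RelMoment.lamHat z) (RelMoment.genVec M W.theta⁻¹ z) ∧
      IsUnit (RelMoment.matD W).det ∧
      RelMoment.IsEigenSystem M (RelMoment.matB0 W) (RelMoment.matB1 W)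
        (RelMoment.lam W.vel z) (RelMoment.eigVec W z) ∧
      ∀ i ∈ Set.Icc (-(M : ℤ)) M, |RelMoment.lam W.vel z i| < 1 := by
  have hζ := inv_pos.2 hθ
  obtain ⟨z, hz⟩ := RelMoment.exists_isZeroList hζ M
  have hD := RelMoment.isUnit_det_matD hM W hρ hu hθ hbulk
  exact ⟨z, hz, hz.isEigenSystem_pair hζ hM, hD, RelMoment.isEigenSystem_moment hu hθ hM hD hz,
    fun i hi => RelMoment.abs_mobius_lt_one hu (hz.abs_lamHat_lt_one hi)⟩
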